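/- Let $r\ge 1$ be a real number. Consider the Cauchy problem for the one-dimensional Schrödinger–Kirchhoff equation $$ \begin{cases} i u_t+\Big(1+\displaystyle\int_{\mathbb R}|u_x(x,t)|^2\,dx\Big)u_{xx}+|u|^{2r}u=0, & x\in\mathbb R,\ t\ge 0,\\[1mm] u(0)=u_0 , \end{cases} $$ for complex-valued $u$. For $T\in(0,\infty]$, a solution on $[0,T)$ is a function $u\in C([0,T);H^1(\mathbb R))\cap C^1([0,T);H^{-1}(\mathbb R))$ with $u(0)=u_0$ that satisfies the equation in $H^{-1}(\mathbb R)$ for every $t\in[0,T)$. For every $u_0\in H^1(\mathbb R)$ there exist $T_{\max}\in(0,\infty]$ and a solution $u\in C([0,T_{\max});H^1(\mathbb R))\cap C^1([0,T_{\max});H^{-1}(\mathbb R))$ on $[0,T_{\max})$ which is unique and maximal: if $v$ is any solution on $[0,T)$ with the same initial datum $u_0$, $T\in(0,\infty]$, then $T\le T_{\max}$ and $v=u$ on $[0,T)$. Moreover, the following blow-up alternative holds: if $T_{\max}<\infty$, then $\|u(t)\|_{H^1}\to+\infty$ as $t\to T_{\max}^-$. -/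

import Mathlib

open MeasureTheory Filter Topology Set TemperedDistribution
open scoped SchwartzMap

noncomputable section

namespace SchrodingerKirchhoff

/-- The complex Hilbert space `L²(ℝ) = L²(ℝ; ℂ)`. -/
abbrev L2 : Type := Lp ℂ 2 (volume : Measure ℝ)

/-- The pairs `(f, g)` of `L²` functions such that `g` is the distributional derivative of `f`. -/
def weakDerivGraph : Submodule ℂ (WithLp 2 (L2 × L2)) where
  carrier := {p | derivCLM ℂ (Lp.toTemperedDistributionCLM ℂ volume 2 p.fst) =
    Lp.toTemperedDistributionCLM ℂ volume 2 p.snd}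
  add_mem' {p q} hp hq := by
    simp only [mem_ofPred_eq, WithLp.add_fst, WithLp.add_snd, map_add] at hp hq ⊢
    rw [hp, hq]
  zero_mem' := by
    simp only [mem_ofPred_eq, WithLp.zero_fst, WithLp.zero_snd, map_zero]
  smul_mem' c p hp := by
    simp only [mem_ofPred_eq, WithLp.smul_fst, WithLp.smul_snd, map_smul] at hp ⊢
    rw [hp]

/-- The Sobolev space `H¹(ℝ) = H¹(ℝ; ℂ)`: an element is an `L²` function `f` that has a weak
derivative `f'` in `L²`, represented as the pair `(f, f')`. The norm, inherited from the `ℓ²`-product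
`L² × L²`, is the usual one, `‖f‖² = ‖f‖²_{L²} + ‖f'‖²_{L²}`. -/
def H1 : Type := weakDerivGraph

instance : NormedAddCommGroup H1 := inferInstanceAs (NormedAddCommGroup weakDerivGraph)

instance : InnerProductSpace ℂ H1 := inferInstanceAs (InnerProductSpace ℂ weakDerivGraph)

/-- The inclusion `H¹(ℝ) → L²(ℝ)`. -/
def H1.toL2 : H1 →L[ℂ] L2 := (WithLp.fstL 2 ℂ L2 L2).comp weakDerivGraph.subtypeL

/-- The weak derivative `u ↦ uₓ`, as a map `H¹(ℝ) → L²(ℝ)`. -/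
def H1.dx : H1 →L[ℂ] L2 := (WithLp.sndL 2 ℂ L2 L2).comp weakDerivGraph.subtypeL

/-- The space `H⁻¹(ℝ)`, the topological dual of `H¹(ℝ)` with the dual norm. -/
abbrev HNeg1 : Type := StrongDual ℂ H1

/-- The bilinear pairing `(f, g) ↦ ∫ f g` (without complex conjugation) on `L²(ℝ)`. -/
def pairing : L2 →L[ℂ] L2 →L[ℂ] ℂ := (ContinuousLinearMap.mul ℂ ℂ).lpPairing volume 2 2

/-- The inclusion `L²(ℝ) → H⁻¹(ℝ)`, `⟨f, φ⟩ = ∫ f φ`. -/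
def L2.toHNeg1 (f : L2) : HNeg1 := (pairing f).comp H1.toL2

/-- The distributional derivative of an `L²` function, as an element of `H⁻¹(ℝ)`:
`⟨f', φ⟩ = - ∫ f φ'`. -/
def L2.dx (f : L2) : HNeg1 := -(pairing f).comp H1.dx

/-- The inclusion `H¹(ℝ) → L²(ℝ) → H⁻¹(ℝ)`. -/
def H1.toHNeg1 (u : H1) : HNeg1 := L2.toHNeg1 (H1.toL2 u)

/-- The second derivative `u ↦ uₓₓ`, as a map `H¹(ℝ) → H⁻¹(ℝ)`. -/
def H1.dxx (u : H1) : HNeg1 := L2.dx (H1.dx u)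

/-- The interval `[0, T)` for `T ∈ (0, ∞]`. -/
def timeInterval (T : EReal) : Set ℝ := {t | 0 ≤ t ∧ (t : EReal) < T}

/-- `u ∈ C([0,T); H¹) ∩ C¹([0,T); H⁻¹)` solves
`i uₜ + (1 + ∫ |uₓ|² dx) uₓₓ + |u|^{2r} u = 0`, `u(0) = u₀`. -/
structure IsSolution (r : ℝ) (u₀ : H1) (T : EReal) (u : ℝ → H1) : Prop where
  continuousOn : ContinuousOn u (timeInterval T)
  initial : u 0 = u₀
  /-- `u` is continuously differentiable on `[0,T)` with values in `H⁻¹` (one-sidedly at `0`), with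
  derivative `ut`, and the equation holds in `H⁻¹` at each `t ∈ [0,T)`, that is, its two sides
  agree on each `φ ∈ H¹`. (Functions in `H¹(ℝ)` lie in `L² ∩ L^∞`, so that `|u|^{2r} u φ` is
  integrable for `r ≥ 0`.) -/
  equation : ∃ ut : ℝ → HNeg1, ContinuousOn ut (timeInterval T) ∧
    ∀ t ∈ timeInterval T,
      HasDerivWithinAt (fun s ↦ H1.toHNeg1 (u s)) (ut t) (timeInterval T) t ∧
      ∀ φ : H1,
        Complex.I * ut t φ
          + ((1 + ∫ x, ‖H1.dx (u t) x‖ ^ 2 : ℝ) : ℂ) * H1.dxx (u t) φ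
          + ∫ x, ((‖H1.toL2 (u t) x‖ ^ (2 * r) : ℝ) : ℂ) * H1.toL2 (u t) x * H1.toL2 φ x = 0

end SchrodingerKirchhoff

end

noncomputable section

namespace SchrodingerKirchhoff

open scoped FourierTransform ENNReal NNReal
open Complex (I)

/-! ### The Fourier transform on `L²(ℝ)` -/

/-! The obstacle is that the coefficient in front of `u_xx` depends on the solution, so the equation
is quasilinear in form. The coefficient depends only on time, however, and it is at least `1`. In
the new time `s` with `ds/dt = 1 + ‖u_x‖²` the equation becomes semilinear, with free part `i u_s +
u_xx`. The free group `e^{i s ∂ₓ²}` is unitary on `L²` and commutes with `∂ₓ`, so `u` and its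
profile `z = e^{-i s ∂ₓ²} u` have the same Kirchhoff coefficient (`coeff_group`). Hence the profile
solves a genuine ODE in `H¹`, `z' = (coeff z)⁻¹ e^{-i s ∂ₓ²} (i |u|^{2r} u)` with `u = e^{i s ∂ₓ²}
z`.

The field of this ODE is bounded and Lipschitz on bounded sets, uniformly in `s`
(`isLipschitzOnBounded_field`). This rests on the embedding of `H¹` in `L^∞` (`H1.ae_norm_le`) and
on the derivative of `|z|^{2r} z` being locally Lipschitz for `r ≥ 1` (`powerDeriv_lipschitz`).
Picard–Lindelöf, with a lifespan that depends only on the norm of the datum, gives a maximal profile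
(`exists_maximal`). Returning to the time `t` is a monotone change of variable
(`exists_timeChange`).

For uniqueness, the profile of an arbitrary solution is shown to be differentiable in `H¹`
(`hasDerivWithinAt_profile`): tested against a fixed function, its two second-derivative terms
cancel. It then follows the same ODE, so it coincides with the maximal profile and cannot outlive it
(`exists_newTime`). Blow-up follows because a profile of norm at most `M` survives for a fixed
amount of new time, and this costs a fixed amount of old time. -/

theorem pairing_eq_integral (f g : L2) : pairing f g = ∫ x, f x * g x := by
  simp [pairing, ContinuousLinearMap.lpPairing_eq_integral]

theorem integrable_mul_comp_neg (f g : L2) : Integrable (fun x ↦ f x * g (-x)) :=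
  (Lp.memLp f).integrable_mul
    ((Lp.memLp g).comp_measurePreserving (Measure.measurePreserving_neg (volume : Measure ℝ)))

/-- Real bump functions, seen as complex ones, are Schwartz, so the fundamental lemma of the
calculus of variations applies to `f - g`. -/
theorem L2.ae_eq_of_forall_integral_eq {f g : ℝ → ℂ} (hf : LocallyIntegrable f)
    (hg : LocallyIntegrable g)
    (h : ∀ φ : 𝓢(ℝ, ℂ), ∫ x, φ x * f x = ∫ x, φ x * g x) :
    f =ᵐ[volume] g := by
  have := ae_eq_zero_of_integral_contDiff_smul_eq_zero (μ := volume) (hf.sub hg) ?_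
  · filter_upwards [this] with x hx
    exact sub_eq_zero.1 hx
  · intro φ hφ hc
    have hc' : HasCompactSupport (Complex.ofRealCLM ∘ φ) := hc.comp_left rfl
    have hs : ContDiff ℝ ((⊤ : ℕ∞) : WithTop ℕ∞) (Complex.ofRealCLM ∘ φ) := by fun_prop
    have key := h (hc'.toSchwartzMap hs)
    have i1 := hf.integrable_smul_left_of_hasCompactSupport hφ.continuous hc
    have i2 := hg.integrable_smul_left_of_hasCompactSupport hφ.continuous hc
    simp only [Pi.sub_apply, smul_sub]
    rw [integral_sub i1 i2]
    simpa [sub_eq_zero] using key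

theorem fourierInv_ae_eq (f : L2) : (𝓕⁻ f : L2) =ᵐ[volume] fun ξ ↦ (𝓕 f : L2) (-ξ) := by
  have hneg := Measure.measurePreserving_neg (volume : Measure ℝ)
  suffices h : (𝓕⁻ f : L2) = Lp.compMeasurePreserving (fun x : ℝ ↦ -x) hneg (𝓕 f : L2) by
    rw [h]
    exact Lp.coeFn_compMeasurePreserving _ hneg
  refine DenseRange.induction_on (SchwartzMap.denseRange_toLpCLM (p := 2) ENNReal.ofNat_ne_top)
    (p := fun f : L2 ↦ (𝓕⁻ f : L2) = Lp.compMeasurePreserving (fun x : ℝ ↦ -x) hneg (𝓕 f : L2)) f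
    ?_ ?_
  · exact isClosed_eq (ContinuousFourierInv.continuous_fourierInv)
      ((Lp.isometry_compMeasurePreserving hneg).continuous.comp
        ContinuousFourier.continuous_fourier)
  · intro φ
    simp only [SchwartzMap.toLpCLM_apply, SchwartzMap.toLp_fourierInv_eq,
      SchwartzMap.toLp_fourier_eq]
    refine Lp.ext ?_
    refine (SchwartzMap.coeFn_toLp _ _ _).trans ?_
    refine EventuallyEq.trans ?_ (Lp.coeFn_compMeasurePreserving _ hneg).symm
    have h2 := hneg.quasiMeasurePreserving.ae_eq_comp (SchwartzMap.coeFn_toLp (𝓕 φ) 2 volume)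
    refine EventuallyEq.trans ?_ h2.symm
    refine Eventually.of_forall fun x ↦ ?_
    simp [SchwartzMap.fourierInv_coe, SchwartzMap.fourier_coe, Real.fourierInv_eq_fourier_neg]

theorem continuous_fourierInv_L2 : Continuous fun f : L2 ↦ (𝓕⁻ f : L2) :=
  (Lp.fourierTransformₗᵢ ℝ ℂ).symm.continuous

/-- The pairing carries no conjugation, so the inverse transform is symmetric rather than unitary
for it. This is Fubini on Schwartz functions, extended by density in one variable at a time. -/
theorem pairing_fourierInv (f g : L2) : pairing (𝓕⁻ f : L2) g = pairing f (𝓕⁻ g : L2) := by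
  refine DenseRange.induction_on (SchwartzMap.denseRange_toLpCLM (p := 2) ENNReal.ofNat_ne_top)
    (p := fun f : L2 ↦ pairing (𝓕⁻ f : L2) g = pairing f (𝓕⁻ g : L2)) f
    (isClosed_eq ((pairing.flip g).continuous.comp continuous_fourierInv_L2)
      (pairing.flip (𝓕⁻ g : L2)).continuous) fun φ ↦ ?_
  refine DenseRange.induction_on (SchwartzMap.denseRange_toLpCLM (p := 2) ENNReal.ofNat_ne_top)
    (p := fun g : L2 ↦ pairing (𝓕⁻ (SchwartzMap.toLpCLM ℂ ℂ 2 volume φ) : L2) g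
      = pairing (SchwartzMap.toLpCLM ℂ ℂ 2 volume φ) (𝓕⁻ g : L2)) g
    (isClosed_eq (pairing _).continuous ((pairing _).continuous.comp continuous_fourierInv_L2))
    fun ψ ↦ ?_
  simp only [SchwartzMap.toLpCLM_apply, SchwartzMap.toLp_fourierInv_eq, pairing_eq_integral]
  have h := SchwartzMap.integral_fourierInv_mul_eq φ ψ
  convert h using 1 <;> refine integral_congr_ae ?_
  · filter_upwards [SchwartzMap.coeFn_toLp (𝓕⁻ φ) 2 volume,
      SchwartzMap.coeFn_toLp ψ 2 volume] with x h1 h2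
    rw [h1, h2]
  · filter_upwards [SchwartzMap.coeFn_toLp (𝓕⁻ ψ) 2 volume,
      SchwartzMap.coeFn_toLp φ 2 volume] with x h1 h2
    rw [h1, h2]

theorem hasTemperateGrowth_ofReal : (fun ξ : ℝ ↦ (ξ : ℂ)).HasTemperateGrowth :=
  Complex.ofRealCLM.hasTemperateGrowth

theorem fourier_derivCLM_apply (f : L2) (φ : 𝓢(ℝ, ℂ)) :
    (𝓕 (derivCLM ℂ (Lp.toTemperedDistributionCLM ℂ volume 2 f)) : 𝓢'(ℝ, ℂ)) φ
      = ∫ ξ : ℝ, φ ξ * (2 * Real.pi * I * ξ * (𝓕 f : L2) ξ) := by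
  have h1 := TemperedDistribution.fourier_lineDerivOp_eq (F := ℂ)
    (Lp.toTemperedDistributionCLM ℂ volume 2 f) (1 : ℝ)
  have h2 : LineDeriv.lineDerivOp (1 : ℝ) (Lp.toTemperedDistributionCLM ℂ volume 2 f) =
      derivCLM ℂ (Lp.toTemperedDistributionCLM ℂ volume 2 f) := by
    ext ψ
    simp only [TemperedDistribution.lineDerivOp_apply_apply, derivCLM_apply_apply]
    congr 2
  rw [← h2, h1, Lp.toTemperedDistributionCLM_apply, Lp.fourier_toTemperedDistribution_eq]
  have h3 : (fun x : ℝ ↦ ((inner ℝ x (1 : ℝ) : ℝ) : ℂ)) = fun ξ : ℝ ↦ (ξ : ℂ) := by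
    ext x; simp
  rw [h3]
  change (2 * Real.pi * I) • (smulLeftCLM ℂ (fun ξ : ℝ ↦ (ξ : ℂ)) (𝓕 f : L2)) φ = _
  rw [TemperedDistribution.smulLeftCLM_apply_apply, Lp.toTemperedDistribution_apply,
    ← integral_smul]
  refine integral_congr_ae (Eventually.of_forall fun ξ ↦ ?_)
  simp [SchwartzMap.smulLeftCLM_apply_apply hasTemperateGrowth_ofReal]
  ring

theorem locallyIntegrable_L2 (f : L2) : LocallyIntegrable f :=
  (Lp.memLp f).locallyIntegrable (by norm_num)

theorem locallyIntegrable_mul_L2 (f : L2) :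
    LocallyIntegrable fun ξ : ℝ ↦ 2 * Real.pi * I * ξ * f ξ := by
  have := (locallyIntegrable_L2 f).continuous_smul (g := fun ξ : ℝ ↦ 2 * Real.pi * I * ξ) (by fun_prop)
  simpa using this

/-- This turns membership in `weakDerivGraph` into a pointwise relation between Fourier transforms,
which every Fourier multiplier visibly preserves. -/
theorem derivCLM_eq_iff (f g : L2) :
    derivCLM ℂ (Lp.toTemperedDistributionCLM ℂ volume 2 f) =
      Lp.toTemperedDistributionCLM ℂ volume 2 g ↔
    (𝓕 g : L2) =ᵐ[volume] fun ξ ↦ 2 * Real.pi * I * ξ * (𝓕 f : L2) ξ := by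
  have hg : ∀ φ : 𝓢(ℝ, ℂ), (𝓕 (Lp.toTemperedDistributionCLM ℂ volume 2 g) : 𝓢'(ℝ, ℂ)) φ
      = ∫ ξ : ℝ, φ ξ * (𝓕 g : L2) ξ := by
    intro φ
    rw [Lp.toTemperedDistributionCLM_apply, Lp.fourier_toTemperedDistribution_eq,
      Lp.toTemperedDistribution_apply]
    simp
  constructor
  · intro h
    refine L2.ae_eq_of_forall_integral_eq (locallyIntegrable_L2 _) (locallyIntegrable_mul_L2 _)
      fun φ ↦ ?_
    rw [← hg, ← fourier_derivCLM_apply, h]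
  · intro h
    have : 𝓕 (derivCLM ℂ (Lp.toTemperedDistributionCLM ℂ volume 2 f)) =
        𝓕 (Lp.toTemperedDistributionCLM ℂ volume 2 g) := by
      ext φ
      rw [hg, fourier_derivCLM_apply]
      refine integral_congr_ae ?_
      filter_upwards [h] with ξ hξ
      rw [hξ]
    have := congrArg (fun T : 𝓢'(ℝ, ℂ) ↦ (𝓕⁻ T : 𝓢'(ℝ, ℂ))) this
    simpa using this

/-! ### The Schrödinger group on `L²(ℝ)` -/

/-- The symbol `exp (-4 π² i s ξ²)` of the Schrödinger propagator. -/
def phase (s ξ : ℝ) : ℂ := Complex.exp ((-(4 * Real.pi ^ 2 * s * ξ ^ 2) : ℝ) * I)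

theorem norm_phase (s ξ : ℝ) : ‖phase s ξ‖ = 1 := Complex.norm_exp_ofReal_mul_I _

theorem phase_neg (s ξ : ℝ) : phase s (-ξ) = phase s ξ := by simp [phase]

theorem phase_zero (ξ : ℝ) : phase 0 ξ = 1 := by simp [phase]

theorem phase_add (s t ξ : ℝ) : phase (s + t) ξ = phase s ξ * phase t ξ := by
  rw [phase, phase, phase, ← Complex.exp_add]
  congr 1
  push_cast
  ring

theorem continuous_phase (s : ℝ) : Continuous (phase s) := by
  unfold phase
  fun_prop

theorem continuous_phase_left (ξ : ℝ) : Continuous fun s ↦ phase s ξ := by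
  unfold phase
  fun_prop

theorem hasDerivAt_phase (s ξ : ℝ) :
    HasDerivAt (fun s ↦ phase s ξ) (-(4 * Real.pi ^ 2 * ξ ^ 2) * I * phase s ξ) s := by
  have h : HasDerivAt (fun s : ℝ ↦ ((-(4 * Real.pi ^ 2 * s * ξ ^ 2) : ℝ) : ℂ) * I)
      (-(4 * Real.pi ^ 2 * ξ ^ 2) * I) s := by
    have h1 : HasDerivAt (fun s : ℝ ↦ -(4 * Real.pi ^ 2 * s * ξ ^ 2))
        (-(4 * Real.pi ^ 2 * ξ ^ 2)) s := by
      have := (((hasDerivAt_id s).const_mul (4 * Real.pi ^ 2)).mul_const (ξ ^ 2)).fun_neg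
      simpa using this
    have := (h1.ofReal_comp).mul_const I
    simpa using this
  have := h.cexp
  rw [mul_comm]
  exact this

theorem memLp_phase_mul (s : ℝ) (f : L2) : MemLp (fun ξ ↦ phase s ξ * f ξ) 2 volume :=
  (Lp.memLp f).of_le
    ((continuous_phase s).aestronglyMeasurable.mul (Lp.memLp f).aestronglyMeasurable)
    (Eventually.of_forall fun ξ ↦ by simp [norm_phase])

/-- Multiplication by the symbol of the Schrödinger propagator. -/
def mulPhase (s : ℝ) : L2 →ₗᵢ[ℂ] L2 where
  toFun f := (memLp_phase_mul s f).toLp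
  map_add' f g := by
    rw [← MemLp.toLp_add]
    refine MemLp.toLp_congr _ _ ?_
    filter_upwards [Lp.coeFn_add f g] with ξ hξ
    rw [hξ]
    simp only [Pi.add_apply, mul_add]
  map_smul' c f := by
    rw [RingHom.id_apply, ← MemLp.toLp_const_smul]
    refine MemLp.toLp_congr _ _ ?_
    filter_upwards [Lp.coeFn_smul c f] with ξ hξ
    rw [hξ]
    simp only [Pi.smul_apply, smul_eq_mul, mul_left_comm]
  norm_map' f := by
    change ‖(memLp_phase_mul s f).toLp‖ = ‖f‖
    rw [Lp.norm_toLp, Lp.norm_def]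
    congr 1
    exact eLpNorm_congr_norm_ae (Eventually.of_forall fun ξ ↦ by simp [norm_phase])

theorem mulPhase_ae_eq (s : ℝ) (f : L2) :
    mulPhase s f =ᵐ[volume] fun ξ ↦ phase s ξ * f ξ :=
  (memLp_phase_mul s f).coeFn_toLp

/-- The Schrödinger propagator `e^{i s ∂ₓ²}` on `L²(ℝ)`. -/
def propagator (s : ℝ) : L2 →ₗᵢ[ℂ] L2 :=
  (Lp.fourierTransformₗᵢ ℝ ℂ).symm.toLinearIsometry.comp
    ((mulPhase s).comp (Lp.fourierTransformₗᵢ ℝ ℂ).toLinearIsometry)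

theorem propagator_apply (s : ℝ) (f : L2) : propagator s f = (𝓕⁻ (mulPhase s (𝓕 f)) : L2) := rfl

theorem fourier_propagator (s : ℝ) (f : L2) :
    (𝓕 (propagator s f) : L2) =ᵐ[volume] fun ξ ↦ phase s ξ * (𝓕 f : L2) ξ := by
  have : (𝓕 (propagator s f) : L2) = mulPhase s (𝓕 f) := by
    rw [propagator_apply, FourierTransform.fourier_fourierInv_eq]
  rw [this]
  exact mulPhase_ae_eq s _

theorem L2.fourier_injective {f g : L2} (h : (𝓕 f : L2) =ᵐ[volume] (𝓕 g : L2)) : f = g :=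
  (Lp.fourierTransformₗᵢ ℝ ℂ).injective (Lp.ext h)

theorem propagator_zero (f : L2) : propagator 0 f = f := by
  refine L2.fourier_injective ((fourier_propagator 0 f).trans ?_)
  exact Eventually.of_forall fun ξ ↦ by simp [phase_zero]

theorem propagator_add (s t : ℝ) (f : L2) :
    propagator (s + t) f = propagator s (propagator t f) := by
  refine L2.fourier_injective ((fourier_propagator _ f).trans ?_)
  filter_upwards [fourier_propagator s (propagator t f), fourier_propagator t f] with ξ h1 h2
  rw [h1, h2, phase_add, mul_assoc]

theorem pairing_propagator_eq_integral (s : ℝ) (f g : L2) :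
    pairing (propagator s f) g = ∫ ξ, phase s ξ * ((𝓕 f : L2) ξ * (𝓕 g : L2) (-ξ)) := by
  rw [propagator_apply, pairing_fourierInv, pairing_eq_integral]
  refine integral_congr_ae ?_
  filter_upwards [mulPhase_ae_eq s (𝓕 f : L2), fourierInv_ae_eq g] with ξ h1 h2
  rw [h1, h2, mul_assoc]

/-- The symbol is even in `ξ`, so the reflection `ξ ↦ -ξ` exchanges the roles of `f` and `g`. -/
theorem pairing_propagator (s : ℝ) (f g : L2) :
    pairing (propagator s f) g = pairing f (propagator s g) := by
  have hc : pairing f (propagator s g) = pairing (propagator s g) f := by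
    simp only [pairing_eq_integral, mul_comm]
  rw [hc, pairing_propagator_eq_integral, pairing_propagator_eq_integral,
    ← integral_neg_eq_self]
  simp only [phase_neg, neg_neg, mul_comm]

/-- Strong continuity, by dominated convergence on the Fourier side. -/
theorem continuous_propagator (f : L2) : Continuous fun s ↦ propagator s f := by
  have hcm : Continuous fun s ↦ mulPhase s (𝓕 f : L2) := by
    refine continuous_iff_continuousAt.2 fun s₀ ↦ ?_
    rw [ContinuousAt, tendsto_iff_norm_sub_tendsto_zero]
    have hsq : ∀ s, ‖mulPhase s (𝓕 f : L2) - mulPhase s₀ (𝓕 f : L2)‖ ^ 2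
        = ∫ ξ, ‖(phase s ξ - phase s₀ ξ) * (𝓕 f : L2) ξ‖ ^ 2 := by
      intro s
      rw [← @inner_self_eq_norm_sq ℂ, L2.inner_def, ← integral_re (L2.integrable_inner _ _)]
      refine integral_congr_ae ?_
      filter_upwards [Lp.coeFn_sub (mulPhase s (𝓕 f : L2)) (mulPhase s₀ (𝓕 f : L2)),
        mulPhase_ae_eq s (𝓕 f : L2), mulPhase_ae_eq s₀ (𝓕 f : L2)] with ξ h1 h2 h3
      rw [inner_self_eq_norm_sq, h1, Pi.sub_apply, h2, h3, sub_mul]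
    have hlim : Tendsto (fun s ↦ ∫ ξ, ‖(phase s ξ - phase s₀ ξ) * (𝓕 f : L2) ξ‖ ^ 2) (𝓝 s₀)
        (𝓝 (∫ ξ : ℝ, (0 : ℝ))) := by
      refine tendsto_integral_filter_of_dominated_convergence
        (fun ξ ↦ 4 * ‖(𝓕 f : L2) ξ‖ ^ 2) ?_ ?_ ?_ ?_
      · refine Eventually.of_forall fun s ↦ ?_
        have := ((continuous_phase s).sub (continuous_phase s₀)).aestronglyMeasurable.mul
          (Lp.memLp (𝓕 f : L2)).aestronglyMeasurable
        exact (this.norm).pow 2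
      · refine Eventually.of_forall fun s ↦ Eventually.of_forall fun ξ ↦ ?_
        have h2 : ‖phase s ξ - phase s₀ ξ‖ ≤ 2 := by
          refine (norm_sub_le _ _).trans ?_
          rw [norm_phase, norm_phase]; norm_num
        rw [Real.norm_of_nonneg (by positivity), norm_mul, mul_pow]
        gcongr
        nlinarith [norm_nonneg (phase s ξ - phase s₀ ξ)]
      · exact ((memLp_two_iff_integrable_sq_norm
          (Lp.memLp (𝓕 f : L2)).aestronglyMeasurable).1 (Lp.memLp _)).const_mul 4
      · refine Eventually.of_forall fun ξ ↦ ?_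
        have h : Continuous fun s ↦ ‖(phase s ξ - phase s₀ ξ) * (𝓕 f : L2) ξ‖ ^ 2 :=
          (((continuous_phase_left ξ).sub continuous_const).mul continuous_const).norm.pow 2
        have := h.tendsto s₀
        simpa using this
    rw [integral_zero] at hlim
    have := (Real.continuous_sqrt.tendsto 0).comp hlim
    rw [Real.sqrt_zero] at this
    refine this.congr fun s ↦ ?_
    rw [Function.comp_apply, ← hsq, Real.sqrt_sq (norm_nonneg _)]
  exact continuous_fourierInv_L2.comp hcm

/-- The propagator preserves pairs consisting of a function and its weak derivative. -/
theorem propagator_mem_weakDerivGraph (s : ℝ) {p : WithLp 2 (L2 × L2)} (hp : p ∈ weakDerivGraph) :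
    WithLp.toLp 2 (propagator s p.fst, propagator s p.snd) ∈ weakDerivGraph := by
  have hp' := (derivCLM_eq_iff _ _).1 hp
  refine (derivCLM_eq_iff _ _).2 ?_
  change (𝓕 (propagator s p.snd) : L2) =ᵐ[volume] fun ξ ↦
    2 * Real.pi * I * ξ * (𝓕 (propagator s p.fst) : L2) ξ
  filter_upwards [hp', fourier_propagator s p.fst, fourier_propagator s p.snd] with ξ h1 h2 h3
  rw [h2, h3, h1]
  ring

/-- Differentiating the symbol produces `ξ²`. One factor `ξ` goes to each function, so one weak
derivative on each side suffices and the derivative is dominated by a product of two `L²` functions.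
-/
theorem hasDerivAt_pairing_propagator {p q : WithLp 2 (L2 × L2)} (hp : p ∈ weakDerivGraph)
    (hq : q ∈ weakDerivGraph) (s : ℝ) :
    HasDerivAt (fun s ↦ pairing (propagator s p.fst) q.fst)
      (-I * pairing (propagator s p.snd) q.snd) s := by
  have hp' := (derivCLM_eq_iff _ _).1 hp
  have hq' := (derivCLM_eq_iff _ _).1 hq
  have hq'' := (Measure.measurePreserving_neg
    (volume : Measure ℝ)).quasiMeasurePreserving.ae_eq_comp hq'
  simp only [pairing_propagator_eq_integral]
  rw [← integral_const_mul]
  refine (hasDerivAt_integral_of_dominated_loc_of_deriv_le (s := univ) univ_mem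
    (F' := fun s ξ ↦ -I * (phase s ξ * ((𝓕 p.snd : L2) ξ * (𝓕 q.snd : L2) (-ξ))))
    (bound := fun ξ ↦ ‖(𝓕 p.snd : L2) ξ * (𝓕 q.snd : L2) (-ξ)‖) ?_ ?_ ?_ ?_ ?_ ?_).2
  · exact Eventually.of_forall fun s ↦ (continuous_phase s).aestronglyMeasurable.mul
      (integrable_mul_comp_neg _ _).aestronglyMeasurable
  · refine (integrable_mul_comp_neg (𝓕 p.fst : L2) (𝓕 q.fst : L2)).mono
      ((continuous_phase s).aestronglyMeasurable.mul
        (integrable_mul_comp_neg _ _).aestronglyMeasurable)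
      (Eventually.of_forall fun ξ ↦ ?_)
    rw [norm_mul, norm_phase, one_mul]
  · exact ((continuous_phase s).aestronglyMeasurable.mul
      (integrable_mul_comp_neg _ _).aestronglyMeasurable).const_mul _
  · refine Eventually.of_forall fun ξ s _ ↦ ?_
    simp [norm_phase]
  · exact (integrable_mul_comp_neg _ _).norm
  · filter_upwards [hp', hq''] with ξ h1 h2 s _
    have h3 : (𝓕 q.snd : L2) (-ξ) = 2 * Real.pi * I * (-ξ : ℝ) * (𝓕 q.fst : L2) (-ξ) := h2
    have := (hasDerivAt_phase s ξ).mul_const ((𝓕 p.fst : L2) ξ * (𝓕 q.fst : L2) (-ξ))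
    refine this.congr_deriv ?_
    rw [h1, h3]
    push_cast
    linear_combination (4 * Real.pi ^ 2 * ξ ^ 2 * I * phase s ξ * (𝓕 p.fst : L2) ξ * (𝓕 q.fst : L2) (-ξ)) * (-Complex.I_sq)

/-! ### The space `H¹(ℝ)` -/

theorem isClosed_weakDerivGraph : IsClosed (weakDerivGraph : Set (WithLp 2 (L2 × L2))) := by
  have h1 : Continuous fun p : WithLp 2 (L2 × L2) ↦
      derivCLM ℂ (Lp.toTemperedDistributionCLM ℂ volume 2 p.fst) :=
    (derivCLM ℂ).continuous.comp ((Lp.toTemperedDistributionCLM ℂ volume 2).continuous.comp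
      (WithLp.fstL 2 ℂ L2 L2).continuous)
  have h2 : Continuous fun p : WithLp 2 (L2 × L2) ↦
      Lp.toTemperedDistributionCLM ℂ volume 2 p.snd :=
    (Lp.toTemperedDistributionCLM ℂ volume 2).continuous.comp (WithLp.sndL 2 ℂ L2 L2).continuous
  exact isClosed_eq h1 h2

instance : CompleteSpace H1 :=
  isClosed_weakDerivGraph.completeSpace_coe

namespace H1

/-- The element of `H¹(ℝ)` given by a function and its weak derivative. -/
def mk (f g : L2) (h : WithLp.toLp 2 (f, g) ∈ weakDerivGraph) : H1 :=
  (⟨WithLp.toLp 2 (f, g), h⟩ : weakDerivGraph)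

theorem mem_weakDerivGraph (u : H1) : WithLp.toLp 2 (toL2 u, dx u) ∈ weakDerivGraph :=
  (show weakDerivGraph from u).2

/-- `L²` embeds in the tempered distributions, so the second component is determined by the first.
Identities in `H¹` can therefore be checked in `L²`. -/
theorem toL2_injective : Function.Injective toL2 := by
  intro u v h
  have hT : Function.Injective (Lp.toTemperedDistributionCLM ℂ (volume : Measure ℝ) 2) :=
    LinearMap.ker_eq_bot.1 Lp.ker_toTemperedDistributionCLM_eq_bot
  have hu : derivCLM ℂ (Lp.toTemperedDistributionCLM ℂ volume 2 (toL2 u)) =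
    Lp.toTemperedDistributionCLM ℂ volume 2 (dx u) := mem_weakDerivGraph u
  have hv : derivCLM ℂ (Lp.toTemperedDistributionCLM ℂ volume 2 (toL2 v)) =
    Lp.toTemperedDistributionCLM ℂ volume 2 (dx v) := mem_weakDerivGraph v
  have hd : dx u = dx v := hT (by rw [← hu, ← hv, h])
  have : WithLp.toLp 2 (toL2 u, dx u) = WithLp.toLp 2 (toL2 v, dx v) := by rw [h, hd]
  exact Subtype.ext this

theorem inner_eq (u v : H1) :
    inner ℂ u v = inner ℂ (toL2 u) (toL2 v) + inner ℂ (dx u) (dx v) :=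
  WithLp.prod_inner_apply (𝕜 := ℂ) (show weakDerivGraph from u).1 (show weakDerivGraph from v).1

theorem norm_sq_eq (u : H1) : ‖u‖ ^ 2 = ‖toL2 u‖ ^ 2 + ‖dx u‖ ^ 2 :=
  WithLp.prod_norm_sq_eq_of_L2 (show weakDerivGraph from u).1

theorem norm_toL2_le (u : H1) : ‖toL2 u‖ ≤ ‖u‖ :=
  abs_le_of_sq_le_sq' (by rw [norm_sq_eq]; nlinarith [sq_nonneg ‖dx u‖]) (norm_nonneg _) |>.2

theorem norm_dx_le (u : H1) : ‖dx u‖ ≤ ‖u‖ :=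
  abs_le_of_sq_le_sq' (by rw [norm_sq_eq]; nlinarith [sq_nonneg ‖toL2 u‖]) (norm_nonneg _) |>.2

theorem norm_le_add (u : H1) : ‖u‖ ≤ ‖toL2 u‖ + ‖dx u‖ :=
  abs_le_of_sq_le_sq' (by rw [norm_sq_eq]; nlinarith [norm_nonneg (toL2 u), norm_nonneg (dx u)])
    (by positivity) |>.2

/-- The Schrödinger propagator `e^{i s ∂ₓ²}` on `H¹(ℝ)`. -/
def group (s : ℝ) : H1 →ₗᵢ[ℂ] H1 where
  toFun u := mk (propagator s (toL2 u)) (propagator s (dx u))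
    (propagator_mem_weakDerivGraph s (mem_weakDerivGraph u))
  map_add' u v := toL2_injective (map_add ((propagator s).toLinearMap ∘ₗ toL2.toLinearMap) u v)
  map_smul' c u := toL2_injective (map_smul ((propagator s).toLinearMap ∘ₗ toL2.toLinearMap) c u)
  norm_map' u := by
    rw [← sq_eq_sq₀ (norm_nonneg _) (norm_nonneg _), norm_sq_eq, norm_sq_eq]
    exact congrArg₂ (fun a b : ℝ ↦ a ^ 2 + b ^ 2) ((propagator s).norm_map _)
      ((propagator s).norm_map _)

@[simp]
theorem toL2_group (s : ℝ) (u : H1) : toL2 (group s u) = propagator s (toL2 u) := rfl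

@[simp]
theorem dx_group (s : ℝ) (u : H1) : dx (group s u) = propagator s (dx u) := rfl

theorem group_zero (u : H1) : group 0 u = u := toL2_injective (by simp [propagator_zero])

theorem group_add (s t : ℝ) (u : H1) : group (s + t) u = group s (group t u) :=
  toL2_injective (by simp [propagator_add])

theorem group_group_neg (s : ℝ) (u : H1) : group s (group (-s) u) = u := by
  rw [← group_add, add_neg_cancel, group_zero]

theorem norm_dx_group (s : ℝ) (u : H1) : ‖dx (group s u)‖ = ‖dx u‖ := by simp

theorem continuous_group (u : H1) : Continuous fun s ↦ group s u := by
  refine continuous_iff_continuousAt.2 fun s₀ ↦ ?_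
  rw [ContinuousAt, tendsto_iff_norm_sub_tendsto_zero]
  have h1 := tendsto_iff_norm_sub_tendsto_zero.1 ((continuous_propagator (toL2 u)).tendsto s₀)
  have h2 := tendsto_iff_norm_sub_tendsto_zero.1 ((continuous_propagator (dx u)).tendsto s₀)
  have h3 := h1.add h2
  rw [add_zero] at h3
  refine squeeze_zero (fun s ↦ norm_nonneg _) (fun s ↦ ?_) h3
  refine (norm_le_add _).trans ?_
  simp

/-- Strong continuity becomes joint continuity because each operator is an isometry. -/
theorem continuous_group_uncurry : Continuous fun p : ℝ × H1 ↦ group p.1 p.2 := by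
  refine continuous_iff_continuousAt.2 fun p₀ ↦ ?_
  rw [ContinuousAt, tendsto_iff_norm_sub_tendsto_zero]
  have h1 := tendsto_iff_norm_sub_tendsto_zero.1
    (((continuous_group p₀.2).comp continuous_fst).tendsto p₀)
  have h2 := tendsto_iff_norm_sub_tendsto_zero.1 (continuous_snd.tendsto p₀)
  have h3 := h2.add h1
  rw [add_zero] at h3
  refine squeeze_zero (fun s ↦ norm_nonneg _) (fun p ↦ ?_) h3
  have : group p.1 p.2 - group p₀.1 p₀.2
      = group p.1 (p.2 - p₀.2) + (group p.1 p₀.2 - group p₀.1 p₀.2) := by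
    rw [map_sub]; abel
  rw [this]
  refine (norm_add_le _ _).trans ?_
  rw [LinearIsometry.norm_map]
  rfl

/-! ### Schwartz functions are dense in `H¹(ℝ)` -/

theorem toLp_mem_weakDerivGraph (φ : 𝓢(ℝ, ℂ)) :
    WithLp.toLp 2 (φ.toLp 2 (volume : Measure ℝ),
      (SchwartzMap.derivCLM ℂ ℂ φ).toLp 2 (volume : Measure ℝ)) ∈ weakDerivGraph := by
  change derivCLM ℂ (Lp.toTemperedDistributionCLM ℂ volume 2 (φ.toLp 2 (volume : Measure ℝ))) =
    Lp.toTemperedDistributionCLM ℂ volume 2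
      ((SchwartzMap.derivCLM ℂ ℂ φ).toLp 2 (volume : Measure ℝ))
  rw [Lp.toTemperedDistributionCLM_apply, Lp.toTemperedDistributionCLM_apply,
    Lp.toTemperedDistribution_toLp_eq, Lp.toTemperedDistribution_toLp_eq,
    derivCLM_toTemperedDistributionCLM_eq ℂ]

/-- The inclusion of Schwartz functions in `H¹(ℝ)`. -/
def ofSchwartz : 𝓢(ℝ, ℂ) →ₗ[ℂ] H1 where
  toFun φ := mk _ _ (toLp_mem_weakDerivGraph φ)
  map_add' φ ψ := toL2_injective
    (map_add (SchwartzMap.toLpCLM ℂ ℂ 2 (volume : Measure ℝ)) φ ψ)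
  map_smul' c φ := toL2_injective
    (map_smul (SchwartzMap.toLpCLM ℂ ℂ 2 (volume : Measure ℝ)) c φ)

@[simp]
theorem toL2_ofSchwartz (φ : 𝓢(ℝ, ℂ)) : toL2 (ofSchwartz φ) = φ.toLp 2 volume := rfl

@[simp]
theorem dx_ofSchwartz (φ : 𝓢(ℝ, ℂ)) :
    dx (ofSchwartz φ) = (SchwartzMap.derivCLM ℂ ℂ φ).toLp 2 volume := rfl

theorem fourier_dx (u : H1) :
    (𝓕 (dx u) : L2) =ᵐ[volume] fun ξ ↦ 2 * Real.pi * I * ξ * (𝓕 (toL2 u) : L2) ξ :=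
  (derivCLM_eq_iff _ _).1 (mem_weakDerivGraph u)

theorem inner_eq_integral_fourier (u v : H1) :
    inner ℂ u v = ∫ ξ : ℝ, (starRingEnd ℂ) ((𝓕 (toL2 u) : L2) ξ) *
      (((1 + 4 * Real.pi ^ 2 * ξ ^ 2 : ℝ) : ℂ) * (𝓕 (toL2 v) : L2) ξ) := by
  rw [inner_eq, ← Lp.inner_fourier_eq, ← Lp.inner_fourier_eq (dx u), L2.inner_def, L2.inner_def,
    ← integral_add (L2.integrable_inner _ _) (L2.integrable_inner _ _)]
  refine integral_congr_ae ?_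
  filter_upwards [fourier_dx u, fourier_dx v] with ξ h1 h2
  rw [h1, h2]
  simp only [RCLike.inner_apply, map_mul, Complex.conj_I, Complex.conj_ofReal, map_ofNat]
  push_cast
  linear_combination (-4 * Real.pi ^ 2 * ξ ^ 2 * (𝓕 (toL2 v) : L2) ξ *
    (starRingEnd ℂ) ((𝓕 (toL2 u) : L2) ξ)) * Complex.I_sq

/-- An element orthogonal to all Schwartz functions is tested against inverse transforms of bump
functions. This forces `(1 + 4π²ξ²) û = 0`, hence `û = 0`. -/
theorem denseRange_ofSchwartz : DenseRange ofSchwartz := by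
  have key : (LinearMap.range ofSchwartz)ᗮ = ⊥ := by
    rw [Submodule.eq_bot_iff]
    intro u hu
    rw [Submodule.mem_orthogonal] at hu
    have hloc : LocallyIntegrable fun ξ : ℝ ↦
        ((1 + 4 * Real.pi ^ 2 * ξ ^ 2 : ℝ) : ℂ) * (𝓕 (toL2 u) : L2) ξ := by
      have := (locallyIntegrable_L2 (𝓕 (toL2 u) : L2)).continuous_smul
        (g := fun ξ : ℝ ↦ ((1 + 4 * Real.pi ^ 2 * ξ ^ 2 : ℝ) : ℂ)) (by fun_prop)
      exact this
    have hz := ae_eq_zero_of_integral_contDiff_smul_eq_zero (μ := volume) hloc ?_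
    · refine toL2_injective (L2.fourier_injective ?_)
      have h0 : (𝓕 (toL2 (0 : H1)) : L2) = 0 := by
        rw [map_zero]; exact (Lp.fourierTransformₗᵢ ℝ ℂ).map_zero
      rw [h0]
      filter_upwards [hz, Lp.coeFn_zero ℂ 2 (volume : Measure ℝ)] with ξ h1 h2
      rw [h2]
      have h3 : ((1 + 4 * Real.pi ^ 2 * ξ ^ 2 : ℝ) : ℂ) ≠ 0 := by
        exact_mod_cast (by positivity : (0 : ℝ) < 1 + 4 * Real.pi ^ 2 * ξ ^ 2).ne'
      exact (mul_eq_zero.1 h1).resolve_left h3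
    · intro φ hφ hc
      have hc' : HasCompactSupport (Complex.ofRealCLM ∘ φ) := hc.comp_left rfl
      have hs : ContDiff ℝ ((⊤ : ℕ∞) : WithTop ℕ∞) (Complex.ofRealCLM ∘ φ) := by fun_prop
      set ψ := hc'.toSchwartzMap hs with hψ
      have h1 := hu (ofSchwartz (𝓕⁻ ψ)) ⟨_, rfl⟩
      rw [inner_eq_integral_fourier, toL2_ofSchwartz, SchwartzMap.toLp_fourier_eq,
        FourierTransform.fourier_fourierInv_eq] at h1
      rw [← h1]
      refine integral_congr_ae ?_
      filter_upwards [ψ.coeFn_toLp 2 volume] with ξ hξ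
      rw [hξ]
      simp [hψ]
  have := Submodule.topologicalClosure_eq_top_iff.2 key
  exact Submodule.dense_iff_topologicalClosure_eq_top.2 this

/-! ### The Sobolev embedding `H¹(ℝ) → L^∞(ℝ)` -/

/-- Integrate `(|φ|²)' = 2 Re (φ̄ φ') ≤ |φ|² + |φ'|²` from `-∞` to `x`; the embedding constant is
`1`. -/
theorem norm_schwartz_le (φ : 𝓢(ℝ, ℂ)) (x : ℝ) : ‖φ x‖ ≤ ‖ofSchwartz φ‖ := by
  have hd : ∀ y, HasDerivAt (fun y ↦ ‖φ y‖ ^ 2)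
      (2 * inner ℝ (φ y) (SchwartzMap.derivCLM ℂ ℂ φ y)) y := fun y ↦
    (φ.differentiableAt.hasDerivAt (x := y)).norm_sq
  have h2 : MemLp φ 2 volume := φ.memLp 2 volume
  have h2' : MemLp (SchwartzMap.derivCLM ℂ ℂ φ) 2 volume := SchwartzMap.memLp _ 2 volume
  have hint : Integrable fun y ↦ 2 * inner ℝ (φ y) (SchwartzMap.derivCLM ℂ ℂ φ y) := by
    refine Integrable.const_mul ?_ 2
    refine (h2.norm.integrable_mul h2'.norm).mono
      (h2.aestronglyMeasurable.inner h2'.aestronglyMeasurable)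
      (Eventually.of_forall fun y ↦ ?_)
    simpa using abs_real_inner_le_norm (φ y) (SchwartzMap.derivCLM ℂ ℂ φ y)
  have hlim : Tendsto (fun y ↦ ‖φ y‖ ^ 2) atBot (𝓝 0) := by
    have h0 : Tendsto φ atBot (𝓝 0) := (zero_at_infty φ).mono_left atBot_le_cocompact
    simpa using h0.norm.pow 2
  have hFTC := integral_Iic_of_hasDerivAt_of_tendsto' (a := x) (fun y _ ↦ hd y)
    hint.integrableOn hlim
  rw [sub_zero] at hFTC
  have hsq : ∀ ψ : 𝓢(ℝ, ℂ), ‖ψ.toLp 2 (volume : Measure ℝ)‖ ^ 2 = ∫ y, ‖ψ y‖ ^ 2 := by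
    intro ψ
    rw [← @inner_self_eq_norm_sq ℂ, L2.inner_def, ← integral_re (L2.integrable_inner _ _)]
    refine integral_congr_ae ?_
    filter_upwards [ψ.coeFn_toLp 2 volume] with y hy
    rw [inner_self_eq_norm_sq, hy]
  have i1 : Integrable fun y ↦ ‖φ y‖ ^ 2 :=
    (memLp_two_iff_integrable_sq_norm h2.aestronglyMeasurable).1 h2
  have i2 : Integrable fun y ↦ ‖SchwartzMap.derivCLM ℂ ℂ φ y‖ ^ 2 :=
    (memLp_two_iff_integrable_sq_norm h2'.aestronglyMeasurable).1 h2'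
  have hle : ‖φ x‖ ^ 2 ≤ ‖ofSchwartz φ‖ ^ 2 := by
    rw [norm_sq_eq, toL2_ofSchwartz, dx_ofSchwartz, hsq, hsq, ← integral_add i1 i2, ← hFTC]
    refine (setIntegral_mono_on hint.integrableOn (i1.add i2).integrableOn measurableSet_Iic
      fun y _ ↦ ?_).trans (setIntegral_le_integral (i1.add i2)
        (Eventually.of_forall fun y ↦ add_nonneg (sq_nonneg _) (sq_nonneg _)))
    have := real_inner_le_norm (φ y) (SchwartzMap.derivCLM ℂ ℂ φ y)
    simp only [Pi.add_apply]
    nlinarith [sq_nonneg (‖φ y‖ - ‖SchwartzMap.derivCLM ℂ ℂ φ y‖)]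
  exact abs_le_of_sq_le_sq' hle (norm_nonneg _) |>.2

/-- Approximate by Schwartz functions and pass to an almost everywhere convergent subsequence. -/
theorem ae_norm_le (u : H1) : ∀ᵐ x, ‖toL2 u x‖ ≤ ‖u‖ := by
  obtain ⟨φ, hφ⟩ : ∃ φ : ℕ → 𝓢(ℝ, ℂ), Tendsto (fun n ↦ ofSchwartz (φ n)) atTop (𝓝 u) := by
    have := mem_closure_iff_seq_limit.1 (denseRange_ofSchwartz u)
    obtain ⟨w, hw, hlim⟩ := this
    choose φ hφ using hw
    exact ⟨φ, by simpa only [hφ] using hlim⟩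
  have h1 : Tendsto (fun n ↦ toL2 (ofSchwartz (φ n))) atTop (𝓝 (toL2 u)) :=
    (toL2.continuous.tendsto u).comp hφ
  obtain ⟨ns, hns, hae⟩ := (tendstoInMeasure_of_tendsto_Lp h1).exists_seq_tendsto_ae
  have hall : ∀ᵐ x, ∀ n, toL2 (ofSchwartz (φ n)) x = φ n x :=
    ae_all_iff.2 fun n ↦ (φ n).coeFn_toLp 2 volume
  filter_upwards [hae, hall] with x hx hx2
  have h3 : Tendsto (fun k ↦ ‖ofSchwartz (φ (ns k))‖) atTop (𝓝 ‖u‖) :=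
    (hφ.comp hns.tendsto_atTop).norm
  refine le_of_tendsto_of_tendsto' hx.norm h3 fun k ↦ ?_
  rw [hx2]
  exact norm_schwartz_le _ _

end H1

/-! ### Superposition operators on `H¹(ℝ)` -/

/-- `h` vanishes at `0` and has derivative `h'`, which is Lipschitz continuous on every ball. -/
structure IsLocallyC11 (h : ℂ → ℂ) (h' : ℂ → ℂ →L[ℝ] ℂ) : Prop where
  map_zero : h 0 = 0
  hasFDerivAt : ∀ z, HasFDerivAt h (h' z) z
  lipschitz_deriv : ∀ M : ℝ, ∃ K : ℝ, 0 ≤ K ∧ ∀ a b : ℂ, ‖a‖ ≤ M → ‖b‖ ≤ M →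
    ‖h' a - h' b‖ ≤ K * ‖a - b‖

namespace IsLocallyC11

variable {h : ℂ → ℂ} {h' : ℂ → ℂ →L[ℝ] ℂ} (H : IsLocallyC11 h h')
include H

theorem continuous : Continuous h :=
  continuous_iff_continuousAt.2 fun z ↦ (H.hasFDerivAt z).continuousAt

theorem continuous_deriv : Continuous h' := by
  refine continuous_iff_continuousAt.2 fun z ↦ ?_
  obtain ⟨K, hK, hlip⟩ := H.lipschitz_deriv (‖z‖ + 1)
  rw [ContinuousAt, tendsto_iff_norm_sub_tendsto_zero]
  have h0 : Tendsto (fun w ↦ K * ‖w - z‖) (𝓝 z) (𝓝 0) := by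
    have : Continuous fun w ↦ K * ‖w - z‖ := by fun_prop
    simpa using this.tendsto z
  refine squeeze_zero' (Eventually.of_forall fun _ ↦ norm_nonneg _) ?_ h0
  filter_upwards [Metric.ball_mem_nhds z one_pos] with w hw
  refine hlip w z ?_ (by linarith)
  have h1 : ‖w - z‖ < 1 := by simpa [dist_eq_norm] using hw
  have h2 : ‖w‖ ≤ ‖z‖ + ‖w - z‖ := by
    simpa using norm_add_le z (w - z)
  linarith

theorem exists_bound_deriv (M : ℝ) : ∃ L : ℝ, 0 ≤ L ∧ ∀ a : ℂ, ‖a‖ ≤ M → ‖h' a‖ ≤ L := by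
  obtain ⟨K, hK, hlip⟩ := H.lipschitz_deriv M
  refine ⟨‖h' 0‖ + K * |M|, by positivity, fun a ha ↦ ?_⟩
  have h1 := hlip a 0 ha (by simpa using (norm_nonneg a).trans ha)
  have h2 : ‖h' a‖ ≤ ‖h' 0‖ + ‖h' a - h' 0‖ := by simpa using norm_add_le (h' 0) (h' a - h' 0)
  have h3 : K * ‖a - 0‖ ≤ K * |M| := by
    rw [sub_zero]
    exact mul_le_mul_of_nonneg_left (ha.trans (le_abs_self M)) hK
  linarith

theorem exists_lipschitz (M : ℝ) : ∃ L : ℝ, 0 ≤ L ∧ ∀ a b : ℂ, ‖a‖ ≤ M → ‖b‖ ≤ M →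
    ‖h a - h b‖ ≤ L * ‖a - b‖ := by
  obtain ⟨L, hL, hb⟩ := H.exists_bound_deriv M
  refine ⟨L, hL, fun a b ha hb' ↦ ?_⟩
  exact (convex_closedBall (0 : ℂ) M).norm_image_sub_le_of_norm_hasFDerivWithin_le (𝕜 := ℝ)
    (fun z _ ↦ (H.hasFDerivAt z).hasFDerivWithinAt) (fun z hz ↦ hb z (by simpa using hz))
    (by simpa using hb') (by simpa using ha)

theorem memLp_comp (u : H1) : MemLp (fun x ↦ h (H1.toL2 u x)) 2 volume := by
  obtain ⟨L, hL, hlip⟩ := H.exists_lipschitz ‖u‖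
  refine ((Lp.memLp (H1.toL2 u)).const_mul (L : ℂ)).of_le
    (H.continuous.comp_aestronglyMeasurable (Lp.memLp _).aestronglyMeasurable) ?_
  filter_upwards [H1.ae_norm_le u] with x hx
  have := hlip _ 0 hx (by simp)
  simpa [H.map_zero, abs_of_nonneg hL] using this

theorem memLp_deriv_comp (u : H1) (g : L2) :
    MemLp (fun x ↦ h' (H1.toL2 u x) (g x)) 2 volume := by
  obtain ⟨L, hL, hb⟩ := H.exists_bound_deriv ‖u‖
  refine ((Lp.memLp g).const_mul (L : ℂ)).of_le ?_ ?_
  · have hc : Continuous fun p : ℂ × ℂ ↦ h' p.1 p.2 :=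
      (H.continuous_deriv.comp continuous_fst).clm_apply continuous_snd
    exact hc.comp_aestronglyMeasurable
      ((Lp.memLp (H1.toL2 u)).aestronglyMeasurable.prodMk (Lp.memLp g).aestronglyMeasurable)
  · filter_upwards [H1.ae_norm_le u] with x hx
    rw [norm_mul, Complex.norm_real, Real.norm_of_nonneg hL]
    exact (h' _).le_of_opNorm_le (hb _ hx) _

theorem norm_comp_sub_le {M L : ℝ}
    (hlip : ∀ a b : ℂ, ‖a‖ ≤ M → ‖b‖ ≤ M → ‖h a - h b‖ ≤ L * ‖a - b‖) {u v : H1}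
    (hu : ‖u‖ ≤ M) (hv : ‖v‖ ≤ M) :
    ‖(H.memLp_comp u).toLp - (H.memLp_comp v).toLp‖ ≤ L * ‖H1.toL2 (u - v)‖ := by
  refine Lp.norm_le_mul_norm_of_ae_le_mul ?_
  rw [← MemLp.toLp_sub, map_sub]
  filter_upwards [((H.memLp_comp u).sub (H.memLp_comp v)).coeFn_toLp,
    Lp.coeFn_sub (H1.toL2 u) (H1.toL2 v), H1.ae_norm_le u, H1.ae_norm_le v] with x h1 h2 h3 h4
  rw [h1, h2]
  exact hlip _ _ (h3.trans hu) (h4.trans hv)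

theorem norm_deriv_comp_sub_le_right {M L : ℝ} (hb : ∀ a : ℂ, ‖a‖ ≤ M → ‖h' a‖ ≤ L) {u : H1}
    (hu : ‖u‖ ≤ M) (f g : L2) :
    ‖(H.memLp_deriv_comp u f).toLp - (H.memLp_deriv_comp u g).toLp‖ ≤ L * ‖f - g‖ := by
  refine Lp.norm_le_mul_norm_of_ae_le_mul ?_
  rw [← MemLp.toLp_sub]
  filter_upwards [((H.memLp_deriv_comp u f).sub (H.memLp_deriv_comp u g)).coeFn_toLp,
    Lp.coeFn_sub f g, H1.ae_norm_le u] with x h1 h2 h3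
  rw [h1, h2, Pi.sub_apply, Pi.sub_apply, ← map_sub]
  exact (h' _).le_of_opNorm_le (hb _ (h3.trans hu)) _

theorem norm_deriv_comp_sub_le_left {M K : ℝ} (hK : 0 ≤ K)
    (hlip : ∀ a b : ℂ, ‖a‖ ≤ M → ‖b‖ ≤ M → ‖h' a - h' b‖ ≤ K * ‖a - b‖) {u v : H1}
    (hu : ‖u‖ ≤ M) (hv : ‖v‖ ≤ M) (g : L2) :
    ‖(H.memLp_deriv_comp u g).toLp - (H.memLp_deriv_comp v g).toLp‖ ≤ K * ‖u - v‖ * ‖g‖ := by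
  refine Lp.norm_le_mul_norm_of_ae_le_mul ?_
  rw [← MemLp.toLp_sub]
  have h5 := H1.ae_norm_le (u - v)
  rw [map_sub] at h5
  filter_upwards [((H.memLp_deriv_comp u g).sub (H.memLp_deriv_comp v g)).coeFn_toLp,
    Lp.coeFn_sub (H1.toL2 u) (H1.toL2 v), H1.ae_norm_le u, H1.ae_norm_le v, h5]
    with x h1 h2 h3 h4 h5
  rw [h1, Pi.sub_apply, ← _root_.sub_apply]
  refine ContinuousLinearMap.le_of_opNorm_le _ ((hlip _ _ (h3.trans hu) (h4.trans hv)).trans ?_) _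
  rw [h2, Pi.sub_apply] at h5
  gcongr

/-- Split `h'(u) uₓ - h'(v) vₓ = h'(u) (uₓ - vₓ) + (h'(u) - h'(v)) vₓ`. The second term places `u -
v` in `L^∞` and `vₓ` in `L²`; it is the reason for requiring a locally Lipschitz `h'`. -/
theorem norm_deriv_comp_dx_sub_le {M L K : ℝ} (hb : ∀ a : ℂ, ‖a‖ ≤ M → ‖h' a‖ ≤ L) (hK : 0 ≤ K)
    (hlip : ∀ a b : ℂ, ‖a‖ ≤ M → ‖b‖ ≤ M → ‖h' a - h' b‖ ≤ K * ‖a - b‖) {u v : H1}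
    (hu : ‖u‖ ≤ M) (hv : ‖v‖ ≤ M) :
    ‖(H.memLp_deriv_comp u (H1.dx u)).toLp - (H.memLp_deriv_comp v (H1.dx v)).toLp‖
      ≤ (L + K * M) * ‖u - v‖ := by
  have h1 := H.norm_deriv_comp_sub_le_right hb hu (H1.dx u) (H1.dx v)
  have h2 := H.norm_deriv_comp_sub_le_left hK hlip hu hv (H1.dx v)
  have h3 := norm_sub_le_norm_sub_add_norm_sub ((H.memLp_deriv_comp u (H1.dx u)).toLp)
    ((H.memLp_deriv_comp u (H1.dx v)).toLp) ((H.memLp_deriv_comp v (H1.dx v)).toLp)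
  have hL : 0 ≤ L := (norm_nonneg _).trans (hb 0 (by simpa using (norm_nonneg u).trans hu))
  have h4 : L * ‖H1.dx u - H1.dx v‖ ≤ L * ‖u - v‖ := by
    rw [← map_sub]
    exact mul_le_mul_of_nonneg_left (H1.norm_dx_le _) hL
  have h5 : K * ‖u - v‖ * ‖H1.dx v‖ ≤ K * ‖u - v‖ * M :=
    mul_le_mul_of_nonneg_left ((H1.norm_dx_le v).trans hv) (by positivity)
  linarith

/-- For Schwartz `φ` the chain rule is classical. Since `h ∘ φ` is only `C¹`, its weak derivative is
identified by integrating by parts against a test function. -/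
theorem mem_weakDerivGraph_ofSchwartz (φ : 𝓢(ℝ, ℂ)) :
    WithLp.toLp 2 ((H.memLp_comp (H1.ofSchwartz φ)).toLp,
      (H.memLp_deriv_comp (H1.ofSchwartz φ) (H1.dx (H1.ofSchwartz φ))).toLp)
      ∈ weakDerivGraph := by
  have e0 : (H.memLp_comp (H1.ofSchwartz φ)).toLp =ᵐ[volume] fun x ↦ h (φ x) := by
    filter_upwards [(H.memLp_comp (H1.ofSchwartz φ)).coeFn_toLp, φ.coeFn_toLp 2 volume]
      with x h1 h2
    rw [h1, H1.toL2_ofSchwartz, h2]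
  have e1 : (H.memLp_deriv_comp (H1.ofSchwartz φ) (H1.dx (H1.ofSchwartz φ))).toLp
      =ᵐ[volume] fun x ↦ h' (φ x) (SchwartzMap.derivCLM ℂ ℂ φ x) := by
    filter_upwards [(H.memLp_deriv_comp (H1.ofSchwartz φ) (H1.dx (H1.ofSchwartz φ))).coeFn_toLp,
      φ.coeFn_toLp 2 volume, (SchwartzMap.derivCLM ℂ ℂ φ).coeFn_toLp 2 volume] with x h1 h2 h3
    rw [h1, H1.toL2_ofSchwartz, H1.dx_ofSchwartz, h2, h3]
  have m0 : MemLp (fun x ↦ h (φ x)) 2 volume := (memLp_congr_ae e0).1 (Lp.memLp _)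
  have m1 : MemLp (fun x ↦ h' (φ x) (SchwartzMap.derivCLM ℂ ℂ φ x)) 2 volume :=
    (memLp_congr_ae e1).1 (Lp.memLp _)
  change derivCLM ℂ (Lp.toTemperedDistributionCLM ℂ volume 2 _) =
    Lp.toTemperedDistributionCLM ℂ volume 2 _
  ext ψ
  have mψ : MemLp ψ 2 volume := ψ.memLp 2 volume
  have mψ' : MemLp (SchwartzMap.derivCLM ℂ ℂ ψ) 2 volume := SchwartzMap.memLp _ 2 volume
  have hd : ∀ x, HasDerivAt (fun x ↦ h (φ x)) (h' (φ x) (SchwartzMap.derivCLM ℂ ℂ φ x)) x :=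
    fun x ↦ (H.hasFDerivAt (φ x)).comp_hasDerivAt x (φ.differentiableAt.hasDerivAt (x := x))
  have hψ : ∀ x, HasDerivAt ψ (SchwartzMap.derivCLM ℂ ℂ ψ x) x :=
    fun x ↦ ψ.differentiableAt.hasDerivAt
  have key := integral_mul_deriv_eq_deriv_mul_of_integrable (fun x _ ↦ hd x) (fun x _ ↦ hψ x)
    (m0.integrable_mul mψ') (m1.integrable_mul mψ) (m0.integrable_mul mψ)
  rw [derivCLM_apply_apply, Lp.toTemperedDistributionCLM_apply, Lp.toTemperedDistributionCLM_apply,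
    Lp.toTemperedDistribution_apply, Lp.toTemperedDistribution_apply]
  have k1 : ∫ x, (-SchwartzMap.derivCLM ℂ ℂ ψ) x • (H.memLp_comp (H1.ofSchwartz φ)).toLp _ x
      = -∫ x, h (φ x) * SchwartzMap.derivCLM ℂ ℂ ψ x := by
    rw [← integral_neg]
    refine integral_congr_ae ?_
    filter_upwards [e0] with x hx
    rw [hx]
    simp [mul_comm]
  have k2 : ∫ x, ψ x • (H.memLp_deriv_comp (H1.ofSchwartz φ) (H1.dx (H1.ofSchwartz φ))).toLp _ x
      = ∫ x, h' (φ x) (SchwartzMap.derivCLM ℂ ℂ φ x) * ψ x := by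
    refine integral_congr_ae ?_
    filter_upwards [e1] with x hx
    rw [hx]
    simp [mul_comm]
  exact k1.trans ((by rw [key, neg_neg] : _ = _).trans k2.symm)

/-- Both components depend continuously on `u ∈ H¹` and the graph is closed, so the chain rule
passes from Schwartz functions to all of `H¹`. -/
theorem mem_weakDerivGraph (u : H1) :
    WithLp.toLp 2 ((H.memLp_comp u).toLp, (H.memLp_deriv_comp u (H1.dx u)).toLp)
      ∈ weakDerivGraph := by
  have hc0 : Continuous fun u : H1 ↦ (H.memLp_comp u).toLp := by
    refine continuous_iff_continuousAt.2 fun u ↦ ?_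
    obtain ⟨L, hL, hlip⟩ := H.exists_lipschitz (‖u‖ + 1)
    rw [ContinuousAt, tendsto_iff_norm_sub_tendsto_zero]
    have h0 : Tendsto (fun w ↦ L * ‖H1.toL2 (w - u)‖) (𝓝 u) (𝓝 0) := by
      have : Continuous fun w ↦ L * ‖H1.toL2 (w - u)‖ := by fun_prop
      simpa using this.tendsto u
    refine squeeze_zero' (Eventually.of_forall fun _ ↦ norm_nonneg _) ?_ h0
    have hev : ∀ᶠ w in 𝓝 u, ‖w‖ < ‖u‖ + 1 :=
      (continuous_norm.tendsto u).eventually_lt_const (by linarith)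
    filter_upwards [hev] with w hw
    exact H.norm_comp_sub_le hlip hw.le (by linarith)
  have hc1 : Continuous fun u : H1 ↦ (H.memLp_deriv_comp u (H1.dx u)).toLp := by
    refine continuous_iff_continuousAt.2 fun u ↦ ?_
    obtain ⟨L, hL, hb⟩ := H.exists_bound_deriv (‖u‖ + 1)
    obtain ⟨K, hK, hlip⟩ := H.lipschitz_deriv (‖u‖ + 1)
    rw [ContinuousAt, tendsto_iff_norm_sub_tendsto_zero]
    have h0 : Tendsto (fun w ↦ (L + K * (‖u‖ + 1)) * ‖w - u‖) (𝓝 u) (𝓝 0) := by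
      have : Continuous fun w ↦ (L + K * (‖u‖ + 1)) * ‖w - u‖ := by fun_prop
      simpa using this.tendsto u
    refine squeeze_zero' (Eventually.of_forall fun _ ↦ norm_nonneg _) ?_ h0
    have hev : ∀ᶠ w in 𝓝 u, ‖w‖ < ‖u‖ + 1 :=
      (continuous_norm.tendsto u).eventually_lt_const (by linarith)
    filter_upwards [hev] with w hw
    exact H.norm_deriv_comp_dx_sub_le hb hK hlip hw.le (by linarith)
  have hc : Continuous fun u : H1 ↦
      WithLp.toLp 2 ((H.memLp_comp u).toLp, (H.memLp_deriv_comp u (H1.dx u)).toLp) :=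
    (WithLp.prod_continuous_toLp 2 L2 L2).comp (hc0.prodMk hc1)
  exact H1.denseRange_ofSchwartz.induction_on u (isClosed_weakDerivGraph.preimage hc)
    H.mem_weakDerivGraph_ofSchwartz

/-- The superposition operator `u ↦ h ∘ u` on `H¹(ℝ)`. -/
def superposition (u : H1) : H1 := H1.mk _ _ (H.mem_weakDerivGraph u)

theorem toL2_superposition (u : H1) :
    H1.toL2 (H.superposition u) =ᵐ[volume] fun x ↦ h (H1.toL2 u x) :=
  (H.memLp_comp u).coeFn_toLp

theorem exists_lipschitz_superposition (M : ℝ) : ∃ C : ℝ, 0 ≤ C ∧ ∀ u v : H1, ‖u‖ ≤ M → ‖v‖ ≤ M →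
    ‖H.superposition u - H.superposition v‖ ≤ C * ‖u - v‖ := by
  obtain ⟨L₀, hL₀, hlip₀⟩ := H.exists_lipschitz M
  obtain ⟨L, hL, hb⟩ := H.exists_bound_deriv M
  obtain ⟨K, hK, hlip⟩ := H.lipschitz_deriv M
  refine ⟨L₀ + (L + K * |M|), by positivity, fun u v hu hv ↦ ?_⟩
  have h1 := (H.norm_comp_sub_le hlip₀ hu hv).trans
    (mul_le_mul_of_nonneg_left (H1.norm_toL2_le _) hL₀)
  have h2 := H.norm_deriv_comp_dx_sub_le hb hK hlip hu hv
  rw [abs_of_nonneg ((norm_nonneg u).trans hu)]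
  refine (H1.norm_le_add _).trans ?_
  rw [map_sub, map_sub, add_mul]
  exact add_le_add h1 h2

end IsLocallyC11

/-! ### The power nonlinearity -/

theorem abs_rpow_sub_rpow_le {q M x y : ℝ} (hq : 1 ≤ q) (hx : 0 ≤ x) (hy : 0 ≤ y) (hxM : x ≤ M)
    (hyM : y ≤ M) : |x ^ q - y ^ q| ≤ q * M ^ (q - 1) * |x - y| := by
  refine (convex_Icc (0 : ℝ) M).norm_image_sub_le_of_norm_hasDerivWithin_le (𝕜 := ℝ)
    (f := fun x : ℝ ↦ x ^ q) (f' := fun x ↦ q * x ^ (q - 1))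
    (fun z _ ↦ (Real.hasDerivAt_rpow_const (Or.inr hq)).hasDerivWithinAt) (fun z hz ↦ ?_)
    ⟨hy, hyM⟩ ⟨hx, hxM⟩
  have h0 : 0 ≤ z ^ (q - 1) := Real.rpow_nonneg hz.1 _
  rw [Real.norm_of_nonneg (by positivity)]
  have := Real.rpow_le_rpow hz.1 hz.2 (by linarith : 0 ≤ q - 1)
  gcongr

/-- For `0 < q < 1` the function `t^q` is not Lipschitz at `0`. The smaller factor `b` repairs this:
`(|a|^q - |b|^q) |b| ≤ |a|^{q+1} - |b|^{q+1}`, where the exponent is at least `1`. -/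
theorem norm_rpow_smul_sub_le_of_le {q M : ℝ} (hq : 0 ≤ q) {a b : ℂ} (hba : ‖b‖ ≤ ‖a‖)
    (ha : ‖a‖ ≤ M) :
    ‖‖a‖ ^ q • a - ‖b‖ ^ q • b‖ ≤ (M ^ q + (q + 1) * M ^ q) * ‖a - b‖ := by
  have hM : 0 ≤ M := (norm_nonneg a).trans ha
  have h1 : ‖a‖ ^ q • a - ‖b‖ ^ q • b = ‖a‖ ^ q • (a - b) + (‖a‖ ^ q - ‖b‖ ^ q) • b := by
    simp only [smul_sub, sub_smul]; abel
  have h2 : ‖‖a‖ ^ q • (a - b)‖ ≤ M ^ q * ‖a - b‖ := by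
    rw [norm_smul, Real.norm_of_nonneg (by positivity)]
    gcongr
  have hpow : ∀ t : ℝ, 0 ≤ t → t ^ q * t = t ^ (q + 1) := fun t ht ↦ by
    rw [Real.rpow_add_one' ht (by linarith)]
  have h3 : ‖(‖a‖ ^ q - ‖b‖ ^ q) • b‖ ≤ (q + 1) * M ^ q * ‖a - b‖ := by
    have h4 : ‖b‖ ^ q ≤ ‖a‖ ^ q := Real.rpow_le_rpow (norm_nonneg _) hba hq
    rw [norm_smul, Real.norm_of_nonneg (by linarith), sub_mul, hpow _ (norm_nonneg b)]
    have h5 : ‖a‖ ^ q * ‖b‖ ≤ ‖a‖ ^ (q + 1) := by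
      rw [← hpow _ (norm_nonneg a)]; gcongr
    have h6 := abs_rpow_sub_rpow_le (q := q + 1) (by linarith) (norm_nonneg a) (norm_nonneg b) ha
      (hba.trans ha)
    rw [add_sub_cancel_right] at h6
    calc ‖a‖ ^ q * ‖b‖ - ‖b‖ ^ (q + 1) ≤ |‖a‖ ^ (q + 1) - ‖b‖ ^ (q + 1)| :=
          le_trans (by linarith) (le_abs_self _)
      _ ≤ (q + 1) * M ^ q * |‖a‖ - ‖b‖| := h6
      _ ≤ (q + 1) * M ^ q * ‖a - b‖ := by
          have := abs_norm_sub_norm_le a b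
          gcongr
  rw [h1, add_mul]
  exact (norm_add_le _ _).trans (add_le_add h2 h3)

theorem norm_rpow_smul_sub_le {q M : ℝ} (hq : 0 ≤ q) {a b : ℂ} (ha : ‖a‖ ≤ M) (hb : ‖b‖ ≤ M) :
    ‖‖a‖ ^ q • a - ‖b‖ ^ q • b‖ ≤ (M ^ q + (q + 1) * M ^ q) * ‖a - b‖ := by
  rcases le_total ‖b‖ ‖a‖ with h | h
  · exact norm_rpow_smul_sub_le_of_le hq h ha
  · rw [norm_sub_rev, norm_sub_rev a]
    exact norm_rpow_smul_sub_le_of_le hq h hb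

/-- The nonlinearity `|z|^{2r} z`. -/
def power (r : ℝ) (z : ℂ) : ℂ := ‖z‖ ^ (2 * r) • z

/-- The real derivative of `|z|^{2r} z`. -/
def powerDeriv (r : ℝ) (z : ℂ) : ℂ →L[ℝ] ℂ :=
  ‖z‖ ^ (2 * r) • ContinuousLinearMap.id ℝ ℂ +
    (2 * r) • (innerSL ℝ z).smulRight (‖z‖ ^ (2 * r - 2) • z)

theorem hasFDerivAt_power {r : ℝ} (hr : 1 ≤ r) (z : ℂ) :
    HasFDerivAt (power r) (powerDeriv r z) z := by
  have h1 := hasFDerivAt_norm_rpow z (p := 2 * r) (by linarith)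
  have h2 := h1.smul (hasFDerivAt_id z)
  refine h2.congr_fderiv ?_
  ext w
  all_goals simp [powerDeriv]
  all_goals ring

theorem powerDeriv_lipschitz {r : ℝ} (hr : 1 ≤ r) (M : ℝ) :
    ∃ K : ℝ, 0 ≤ K ∧ ∀ a b : ℂ, ‖a‖ ≤ M → ‖b‖ ≤ M →
      ‖powerDeriv r a - powerDeriv r b‖ ≤ K * ‖a - b‖ := by
  rcases lt_or_ge M 0 with hM | hM
  · exact ⟨0, le_rfl, fun a _ ha ↦ absurd (ha.trans_lt hM) (norm_nonneg a).not_gt⟩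
  -- Here `r ≥ 1` enters: the exponent in the second term of the derivative is nonnegative.
  set q := 2 * r - 2 with hq
  have hq0 : 0 ≤ q := by linarith
  set C := M ^ q + (q + 1) * M ^ q with hC
  have hC0 : 0 ≤ C := by positivity
  refine ⟨2 * r * M ^ (2 * r - 1) + 2 * r * (M ^ q * M + M * C), by positivity,
    fun a b ha hb ↦ ?_⟩
  have h1 : ‖(‖a‖ ^ (2 * r) - ‖b‖ ^ (2 * r)) • ContinuousLinearMap.id ℝ ℂ‖ ≤
      2 * r * M ^ (2 * r - 1) * ‖a - b‖ := by
    rw [norm_smul, ContinuousLinearMap.norm_id, mul_one]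
    refine (abs_rpow_sub_rpow_le (by linarith) (norm_nonneg a) (norm_nonneg b) ha hb).trans ?_
    have := abs_norm_sub_norm_le a b
    gcongr
  have h2 : ‖(innerSL ℝ a).smulRight (‖a‖ ^ q • a) - (innerSL ℝ b).smulRight (‖b‖ ^ q • b)‖ ≤
      (M ^ q * M + M * C) * ‖a - b‖ := by
    have e : (innerSL ℝ a).smulRight (‖a‖ ^ q • a) - (innerSL ℝ b).smulRight (‖b‖ ^ q • b) =
        (innerSL ℝ (a - b)).smulRight (‖a‖ ^ q • a) +
          (innerSL ℝ b).smulRight (‖a‖ ^ q • a - ‖b‖ ^ q • b) := by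
      refine ContinuousLinearMap.ext fun w ↦ ?_
      simp only [_root_.sub_apply, _root_.add_apply, ContinuousLinearMap.smulRight_apply, map_sub,
        sub_smul, smul_sub]
      abel
    rw [e]
    refine (norm_add_le _ _).trans ?_
    rw [ContinuousLinearMap.norm_smulRight_apply, ContinuousLinearMap.norm_smulRight_apply,
      innerSL_apply_norm, innerSL_apply_norm, norm_smul, Real.norm_of_nonneg (by positivity)]
    have h3 : ‖a - b‖ * (‖a‖ ^ q * ‖a‖) ≤ ‖a - b‖ * (M ^ q * M) := by gcongr
    have h4 : ‖b‖ * ‖‖a‖ ^ q • a - ‖b‖ ^ q • b‖ ≤ M * (C * ‖a - b‖) :=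
      mul_le_mul hb (norm_rpow_smul_sub_le hq0 ha hb) (norm_nonneg _) hM
    linarith
  have e : powerDeriv r a - powerDeriv r b =
      (‖a‖ ^ (2 * r) - ‖b‖ ^ (2 * r)) • ContinuousLinearMap.id ℝ ℂ +
        (2 * r) • ((innerSL ℝ a).smulRight (‖a‖ ^ q • a) -
          (innerSL ℝ b).smulRight (‖b‖ ^ q • b)) := by
    refine ContinuousLinearMap.ext fun w ↦ ?_
    simp [powerDeriv, hq]
    ring
  rw [e]
  refine (norm_add_le _ _).trans ?_
  rw [norm_smul (2 * r), Real.norm_of_nonneg (by linarith), add_mul, mul_assoc (2 * r) (_ + _)]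
  gcongr

theorem isLocallyC11_power {r : ℝ} (hr : 1 ≤ r) : IsLocallyC11 (power r) (powerDeriv r) where
  map_zero := by simp [power]
  hasFDerivAt := hasFDerivAt_power hr
  lipschitz_deriv := powerDeriv_lipschitz hr

/-! ### Ordinary differential equations with a field that is Lipschitz on bounded sets -/

section ODE

variable {E : Type*} [NormedAddCommGroup E] [NormedSpace ℝ E]

/-- Two solutions on a compact interval stay in a common ball, where a single Lipschitz constant
feeds the usual uniqueness theorem. -/
theorem eqOn_of_hasDerivWithinAt_Icc {v : ℝ → E → E} {f g : ℝ → E} {a b : ℝ}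
    (hv : ∀ M : ℝ, ∃ K : ℝ≥0, ∀ t ∈ Icc a b, LipschitzOnWith K (v t) (Metric.closedBall 0 M))
    (hf : ∀ t ∈ Icc a b, HasDerivWithinAt f (v t (f t)) (Icc a b) t)
    (hg : ∀ t ∈ Icc a b, HasDerivWithinAt g (v t (g t)) (Icc a b) t) (hab : f a = g a) :
    EqOn f g (Icc a b) := by
  have hfc : ContinuousOn f (Icc a b) := fun t ht ↦ (hf t ht).continuousWithinAt
  have hgc : ContinuousOn g (Icc a b) := fun t ht ↦ (hg t ht).continuousWithinAt
  obtain ⟨M₁, hM₁⟩ := isCompact_Icc.exists_bound_of_continuousOn hfc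
  obtain ⟨M₂, hM₂⟩ := isCompact_Icc.exists_bound_of_continuousOn hgc
  obtain ⟨K, hK⟩ := hv (max M₁ M₂)
  refine ODE_solution_unique_of_mem_Icc_right (v := v)
    (s := fun _ ↦ Metric.closedBall 0 (max M₁ M₂)) (fun t ht ↦ hK t (Ico_subset_Icc_self ht))
    hfc (fun t ht ↦ ?_) (fun t ht ↦ ?_) hgc (fun t ht ↦ ?_) (fun t ht ↦ ?_) hab
  · exact (hf t (Ico_subset_Icc_self ht)).mono_of_mem_nhdsWithin (Icc_mem_nhdsGE_of_mem ht)
  · simpa using Or.inl (hM₁ t (Ico_subset_Icc_self ht))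
  · exact (hg t (Ico_subset_Icc_self ht)).mono_of_mem_nhdsWithin (Icc_mem_nhdsGE_of_mem ht)
  · simpa using Or.inr (hM₂ t (Ico_subset_Icc_self ht))

/-- The solutions on `[a,b]` and on `[b,c]` are glued to a solution on `[a,c]`. -/
theorem exists_glue_hasDerivWithinAt {G : ℝ → E → E} {f g : ℝ → E} {a b c : ℝ} (hab : a ≤ b) (hbc : b ≤ c)
    (hf : ∀ s ∈ Icc a b, HasDerivWithinAt f (G s (f s)) (Icc a b) s)
    (hg : ∀ s ∈ Icc b c, HasDerivWithinAt g (G s (g s)) (Icc b c) s) (h : f b = g b) :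
    ∃ k : ℝ → E, EqOn k f (Icc a b) ∧ EqOn k g (Icc b c) ∧
      ∀ s ∈ Icc a c, HasDerivWithinAt k (G s (k s)) (Icc a c) s := by
  set k : ℝ → E := fun s ↦ if s ≤ b then f s else g s
  have hkf : EqOn k f (Icc a b) := fun s hs ↦ if_pos hs.2
  have hkg : EqOn k g (Icc b c) := fun s hs ↦ by
    rcases hs.1.eq_or_lt with rfl | hlt
    · exact (if_pos le_rfl).trans h
    · exact if_neg hlt.not_ge
  refine ⟨k, hkf, hkg, fun s hs ↦ ?_⟩
  rw [← Icc_union_Icc_eq_Icc hab hbc]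
  refine HasDerivWithinAt.union ?_ ?_
  · by_cases hsb : s ≤ b
    · have := hf s ⟨hs.1, hsb⟩
      rw [← hkf ⟨hs.1, hsb⟩] at this
      exact this.congr_of_mem hkf ⟨hs.1, hsb⟩
    · refine HasFDerivWithinAt.of_notMem_closure ?_
      rw [isClosed_Icc.closure_eq]
      exact fun h ↦ hsb h.2
  · by_cases hsb : b ≤ s
    · have := hg s ⟨hsb, hs.2⟩
      rw [← hkg ⟨hsb, hs.2⟩] at this
      exact this.congr_of_mem hkg ⟨hsb, hs.2⟩
    · refine HasFDerivWithinAt.of_notMem_closure ?_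
      rw [isClosed_Icc.closure_eq]
      exact fun h ↦ hsb h.1

/-- A vector field that is continuous in time and, uniformly in time, bounded and Lipschitz
continuous on bounded sets. -/
structure IsLipschitzOnBounded (G : ℝ → E → E) : Prop where
  continuous_left : ∀ x, Continuous fun s ↦ G s x
  lipschitz : ∀ M : ℝ, ∃ K : ℝ≥0, ∀ s, LipschitzOnWith K (G s) (Metric.closedBall 0 M)
  bounded : ∀ M : ℝ, ∃ L : ℝ≥0, ∀ s x, ‖x‖ ≤ M → ‖G s x‖ ≤ L

namespace IsLipschitzOnBounded

variable {G : ℝ → E → E} (hG : IsLipschitzOnBounded G)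
include hG

/-- Picard–Lindelöf in the unit ball around `x₀`. With `L` a bound of the field on the ball of
radius `M + 1`, the time `1 / (L + 1)` is too short to leave that unit ball, and it depends only on
`M`. -/
theorem exists_local [CompleteSpace E] (M : ℝ) : ∃ δ : ℝ, 0 < δ ∧ ∀ (s₀ : ℝ) (x₀ : E), ‖x₀‖ ≤ M →
    ∃ α : ℝ → E, α s₀ = x₀ ∧ ∀ s ∈ Icc s₀ (s₀ + δ),
      HasDerivWithinAt α (G s (α s)) (Icc s₀ (s₀ + δ)) s ∧ ‖α s‖ ≤ M + 1 := by
  obtain ⟨K, hK⟩ := hG.lipschitz (M + 1)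
  obtain ⟨L, hL⟩ := hG.bounded (M + 1)
  have hδ : (0 : ℝ) < (L + 1 : ℝ)⁻¹ := by positivity
  refine ⟨(L + 1 : ℝ)⁻¹, hδ, fun s₀ x₀ hx₀ ↦ ?_⟩
  have hball : ∀ x ∈ Metric.closedBall x₀ (1 : ℝ≥0), ‖x‖ ≤ M + 1 := by
    intro x hx
    have h1 : ‖x - x₀‖ ≤ 1 := by simpa [dist_eq_norm] using hx
    have h2 : ‖x‖ ≤ ‖x₀‖ + ‖x - x₀‖ := by simpa using norm_add_le x₀ (x - x₀)
    linarith
  have hPL : IsPicardLindelof G (tmin := s₀) (tmax := s₀ + (L + 1 : ℝ)⁻¹)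
      ⟨s₀, le_rfl, by linarith⟩ x₀ 1 0 L K :=
    { lipschitzOnWith := fun t _ ↦ (hK t).mono fun x hx ↦ by simpa using hball x hx
      continuousOn := fun x _ ↦ (hG.continuous_left x).continuousOn
      norm_le := fun t _ x hx ↦ hL t x (hball x hx)
      mul_max_le := by
        simp only [add_sub_cancel_left, sub_self, NNReal.coe_one, NNReal.coe_zero, sub_zero]
        rw [max_eq_left hδ.le, ← div_eq_mul_inv, div_le_one (by positivity)]
        linarith }
  -- The fixed point is used directly because it also records that the curve stays in the ball,
  -- which yields the bound `M + 1`.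
  obtain ⟨α, hα⟩ := ODE.FunSpace.exists_isFixedPt_next hPL (Metric.mem_closedBall_self (by simp))
  have hmem : ∀ s, α.compProj s ∈ Metric.closedBall x₀ (1 : ℝ≥0) := fun s ↦
    α.compProj_mem_closedBall hPL.mul_max_le
  refine ⟨α.compProj, ?_, fun s hs ↦ ⟨?_, hball _ (hmem s)⟩⟩
  · have := ODE.FunSpace.compProj_val (α := α) (t := ⟨s₀, le_rfl, by linarith⟩)
    refine this.trans ?_
    rw [← hα, ODE.FunSpace.next_apply₀]
  · refine (ODE.hasDerivWithinAt_picard_Icc (t₀ := s₀) ⟨le_rfl, by linarith⟩ hPL.continuousOn_uncurry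
      α.continuous_compProj.continuousOn (fun t _ ↦ hmem t) x₀ hs).congr_of_mem (fun t ht ↦ ?_) hs
    nth_rw 1 [← hα]
    rw [ODE.FunSpace.compProj_of_mem ht, ODE.FunSpace.next_apply]

/-- The maximal forward solution: it lives on an interval `J` starting at `0`, and it can be
continued past each of its points by a time that only depends on a bound of its value there. -/
theorem exists_maximal [CompleteSpace E] (x₀ : E) : ∃ (J : Set ℝ) (z : ℝ → E),
    (0 : ℝ) ∈ J ∧ (∀ s ∈ J, 0 ≤ s) ∧ (∀ s ∈ J, Icc 0 s ⊆ J) ∧ z 0 = x₀ ∧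
    (∀ s ∈ J, HasDerivWithinAt z (G s (z s)) J s) ∧
    ∀ M : ℝ, ∃ δ : ℝ, 0 < δ ∧ ∀ s ∈ J, ‖z s‖ ≤ M →
      s + δ ∈ J ∧ ∀ s' ∈ Icc s (s + δ), ‖z s'‖ ≤ M + 1 := by
  let P (S : ℝ) (α : ℝ → E) : Prop :=
    α 0 = x₀ ∧ ∀ s ∈ Icc 0 S, HasDerivWithinAt α (G s (α s)) (Icc 0 S) s
  let J : Set ℝ := {S | 0 ≤ S ∧ ∃ α, P S α}
  have hPmono : ∀ {S S' α}, S' ≤ S → P S α → P S' α := fun h hP ↦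
    ⟨hP.1, fun s hs ↦ (hP.2 s ⟨hs.1, hs.2.trans h⟩).mono (Icc_subset_Icc_right h)⟩
  have huniq : ∀ {S α β}, P S α → P S β → EqOn α β (Icc 0 S) := fun hα hβ ↦
    eqOn_of_hasDerivWithinAt_Icc (fun M ↦ (hG.lipschitz M).imp fun K hK t _ ↦ hK t) hα.2 hβ.2
      (hα.1.trans hβ.1.symm)
  classical
  -- By uniqueness the choice of solution at each `s` is immaterial; the value `0` outside `J` is
  -- never used.
  let z : ℝ → E := fun s ↦ if h : s ∈ J then h.2.choose s else 0
  have hz : ∀ {S α}, P S α → EqOn z α (Icc 0 S) := by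
    intro S α hα s hs
    have hsJ : s ∈ J := ⟨hs.1, α, hPmono hs.2 hα⟩
    have : z s = hsJ.2.choose s := dif_pos hsJ
    rw [this]
    exact huniq hsJ.2.choose_spec (hPmono hs.2 hα) ⟨hs.1, le_rfl⟩
  have hdown : ∀ s ∈ J, Icc 0 s ⊆ J := fun s ⟨_, α, hα⟩ s' hs' ↦ ⟨hs'.1, α, hPmono hs'.2 hα⟩
  have hext : ∀ M : ℝ, ∃ δ : ℝ, 0 < δ ∧ ∀ s ∈ J, ‖z s‖ ≤ M →
      s + δ ∈ J ∧ ∀ s' ∈ Icc s (s + δ), ‖z s'‖ ≤ M + 1 := by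
    intro M
    obtain ⟨δ, hδ, hloc⟩ := hG.exists_local M
    refine ⟨δ, hδ, fun s ⟨hs0, α, hα⟩ hM ↦ ?_⟩
    obtain ⟨β, hβ0, hβ⟩ := hloc s (z s) hM
    obtain ⟨k, hk1, hk2, hk⟩ := exists_glue_hasDerivWithinAt hs0 (by linarith) hα.2 (fun s hs ↦ (hβ s hs).1)
      (by rw [hβ0, hz hα ⟨hs0, le_rfl⟩])
    have hPk : P (s + δ) k := ⟨(hk1 ⟨le_rfl, hs0⟩).trans hα.1, hk⟩
    refine ⟨⟨by linarith, k, hPk⟩, fun s' hs' ↦ ?_⟩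
    rw [hz hPk ⟨hs0.trans hs'.1, hs'.2⟩, hk2 hs']
    exact (hβ s' hs').2
  have h0 : (0 : ℝ) ∈ J := by
    obtain ⟨δ, hδ, hloc⟩ := hG.exists_local ‖x₀‖
    obtain ⟨β, hβ0, hβ⟩ := hloc 0 x₀ le_rfl
    refine ⟨le_rfl, β, hPmono hδ.le ⟨hβ0, fun s hs ↦ ?_⟩⟩
    simpa using (hβ s (by simpa using hs)).1
  refine ⟨J, z, h0, fun s hs ↦ hs.1, hdown, ?_, fun s hs ↦ ?_, hext⟩
  · obtain ⟨_, α, hα⟩ := h0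
    exact (hz hα ⟨le_rfl, le_rfl⟩).trans hα.1
  -- A solution living past `s` is needed, so that `[0, s + δ]` is a neighbourhood of `s` within
  -- `J`.
  · obtain ⟨δ, hδ, h⟩ := hext ‖z s‖
    obtain ⟨⟨hS0, α, hα⟩, -⟩ := h s hs le_rfl
    have hs' : s ∈ Icc 0 (s + δ) := ⟨hs.1, by linarith⟩
    have h1 := (hα.2 s hs').congr_of_mem (hz hα) hs'
    rw [← hz hα hs'] at h1
    refine h1.mono_of_mem_nhdsWithin ?_
    filter_upwards [self_mem_nhdsWithin, mem_nhdsWithin_of_mem_nhds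
      (Iio_mem_nhds (by linarith : s < s + δ))] with x hx hx2
    exact ⟨hx.1, le_of_lt hx2⟩

end IsLipschitzOnBounded

end ODE

/-! ### Change of the time variable -/

theorem mul_sub_le_of_hasDerivWithinAt {f f' : ℝ → ℝ} {a b κ : ℝ} (hab : a ≤ b)
    (hf : ∀ s ∈ Icc a b, HasDerivWithinAt f (f' s) (Icc a b) s) (hκ : ∀ s ∈ Icc a b, κ ≤ f' s) :
    κ * (b - a) ≤ f b - f a := by
  have hd : ∀ s ∈ Ioo a b, HasDerivAt f (f' s) s := fun s hs ↦
    (hf s (Ioo_subset_Icc_self hs)).hasDerivAt (Icc_mem_nhds hs.1 hs.2)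
  refine (convex_Icc a b).mul_sub_le_image_sub_of_le_deriv
    (fun s hs ↦ (hf s hs).continuousWithinAt) ?_ ?_ a ⟨le_rfl, hab⟩ b ⟨hab, le_rfl⟩ hab
  · rw [interior_Icc]
    exact fun s hs ↦ (hd s hs).differentiableAt.differentiableWithinAt
  · rw [interior_Icc]
    intro s hs
    rw [(hd s hs).deriv]
    exact hκ s (Ioo_subset_Icc_self hs)

theorem Icc_subset_timeInterval {T : EReal} {t : ℝ} (ht : t ∈ timeInterval T) :
    Icc 0 t ⊆ timeInterval T := fun _ hs ↦
  ⟨hs.1, (EReal.coe_le_coe_iff.2 hs.2).trans_lt ht.2⟩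

theorem convex_timeInterval (T : EReal) : Convex ℝ (timeInterval T) := by
  refine OrdConnected.convex ⟨fun a ha b hb c hc ↦ ?_⟩
  exact Icc_subset_timeInterval hb ⟨ha.1.trans hc.1, hc.2⟩

/-- A new time `τ` with derivative `c > 0` on the interval `J`, and its inverse `σ`. -/
theorem exists_timeChange {J : Set ℝ} {c : ℝ → ℝ} (h0 : (0 : ℝ) ∈ J) (hnonneg : ∀ s ∈ J, 0 ≤ s)
    (hdown : ∀ s ∈ J, Icc 0 s ⊆ J) (hopen : ∀ s ∈ J, ∃ s' ∈ J, s < s') (hc : ContinuousOn c J)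
    (hpos : ∀ s ∈ J, 0 < c s) :
    ∃ (T : EReal) (τ σ : ℝ → ℝ), 0 < T ∧ τ 0 = 0 ∧ (∀ s ∈ J, HasDerivWithinAt τ (c s) J s) ∧
      StrictMonoOn τ J ∧ MapsTo τ J (timeInterval T) ∧
      (∀ t ∈ timeInterval T, σ t ∈ J ∧ τ (σ t) = t) ∧
      ∀ t ∈ timeInterval T, HasDerivWithinAt σ (c (σ t))⁻¹ (timeInterval T) t := by
  let τ : ℝ → ℝ := fun s ↦ ∫ x in (0 : ℝ)..s, c x
  have hnhds : ∀ s ∈ J, ∃ s' ∈ J, s < s' ∧ Icc 0 s' ∈ 𝓝[J] s := by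
    intro s hs
    obtain ⟨s', hs', hlt⟩ := hopen s hs
    refine ⟨s', hs', hlt, ?_⟩
    filter_upwards [self_mem_nhdsWithin, mem_nhdsWithin_of_mem_nhds (Iio_mem_nhds hlt)]
      with x hx hx2
    exact ⟨hnonneg x hx, le_of_lt hx2⟩
  have hτ : ∀ s ∈ J, HasDerivWithinAt τ (c s) J s := by
    intro s hs
    obtain ⟨s', hs', hlt, hmem⟩ := hnhds s hs
    have hcs' : ContinuousOn c (Icc 0 s') := hc.mono (hdown s' hs')
    have hsI : s ∈ Icc 0 s' := ⟨hnonneg s hs, hlt.le⟩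
    have : Fact (s ∈ Icc 0 s') := ⟨hsI⟩
    refine HasDerivWithinAt.mono_of_mem_nhdsWithin (t := Icc 0 s') ?_ hmem
    refine intervalIntegral.integral_hasDerivWithinAt_right (s := Icc 0 s') (t := Icc 0 s') ?_
      (hcs'.stronglyMeasurableAtFilter_nhdsWithin measurableSet_Icc s) (hcs' s hsI)
    refine (hcs'.mono ?_).intervalIntegrable
    rw [uIcc_of_le hsI.1]
    exact Icc_subset_Icc_right hsI.2
  have hIcc : ∀ {a b}, a ∈ J → b ∈ J → Icc a b ⊆ J := fun ha hb x hx ↦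
    hdown _ hb ⟨(hnonneg _ ha).trans hx.1, hx.2⟩
  -- There need be no positive lower bound for `c` on all of `J`, only one on each compact piece.
  have hlow : ∀ S ∈ J, ∃ κ : ℝ, 0 < κ ∧ ∀ s ∈ Icc 0 S, κ ≤ c s := by
    intro S hS
    obtain ⟨m, hm, hmin⟩ := isCompact_Icc.exists_isMinOn (nonempty_Icc.2 (hnonneg S hS))
      (hc.mono (hdown S hS))
    exact ⟨c m, hpos m (hdown S hS hm), fun s hs ↦ hmin hs⟩
  have hgrow : ∀ {S κ}, S ∈ J → (∀ s ∈ Icc 0 S, κ ≤ c s) → ∀ {a b}, a ∈ J → b ∈ Icc 0 S →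
      a ≤ b → κ * (b - a) ≤ τ b - τ a := by
    intro S κ hS hκ a b ha hb hab
    have hbJ := hdown S hS hb
    exact mul_sub_le_of_hasDerivWithinAt hab
      (fun s hs ↦ (hτ s (hIcc ha hbJ hs)).mono (hIcc ha hbJ))
      fun s hs ↦ hκ s ⟨(hnonneg a ha).trans hs.1, hs.2.trans hb.2⟩
  have hmono : StrictMonoOn τ J := by
    intro a ha b hb hab
    obtain ⟨κ, hκ, hle⟩ := hlow b hb
    have := hgrow hb hle ha ⟨hnonneg b hb, le_rfl⟩ hab.le
    nlinarith [mul_pos hκ (sub_pos.2 hab)]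
  have hτ0 : τ 0 = 0 := intervalIntegral.integral_same
  let T : EReal := sSup ((fun s ↦ (τ s : EReal)) '' J)
  have hmaps : MapsTo τ J (timeInterval T) := by
    intro s hs
    refine ⟨?_, ?_⟩
    · rw [← hτ0]
      exact hmono.monotoneOn h0 hs (hnonneg s hs)
    · obtain ⟨s', hs', hlt⟩ := hopen s hs
      refine (EReal.coe_lt_coe_iff.2 (hmono hs hs' hlt)).trans_le (le_sSup ⟨s', hs', rfl⟩)
  have hsurj : ∀ t ∈ timeInterval T, ∃ s ∈ J, τ s = t := by
    intro t ht
    obtain ⟨_, ⟨S, hS, rfl⟩, hlt⟩ := lt_sSup_iff.1 ht.2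
    have hcont : ContinuousOn τ (Icc 0 S) := fun s hs ↦
      ((hτ s (hdown S hS hs)).mono (hdown S hS)).continuousWithinAt
    obtain ⟨s, hs, rfl⟩ := intermediate_value_Icc (hnonneg S hS) hcont
      (show t ∈ Icc (τ 0) (τ S) from ⟨by rw [hτ0]; exact ht.1, (EReal.coe_lt_coe_iff.1 hlt).le⟩)
    exact ⟨s, hdown S hS hs, rfl⟩
  choose! σ hσJ hσ using hsurj
  have hT : 0 < T := by
    have := (hmaps h0).2
    rwa [hτ0] at this
  refine ⟨T, τ, σ, hT, hτ0, hτ, hmono, hmaps, fun t ht ↦ ⟨hσJ t ht, hσ t ht⟩, fun t ht ↦ ?_⟩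
  have hσmono : ∀ {t₁ t₂}, t₁ ∈ timeInterval T → t₂ ∈ timeInterval T → t₁ ≤ t₂ → σ t₁ ≤ σ t₂ := by
    intro t₁ t₂ h1 h2 h
    rw [← hmono.le_iff_le (hσJ _ h1) (hσJ _ h2), hσ _ h1, hσ _ h2]
    exact h
  -- Near `t` the speed of `τ` is at least `κ`, so its inverse satisfies `|σ x - σ t| ≤ κ⁻¹ |x -
  -- t|`.
  have hcont : ContinuousWithinAt σ (timeInterval T) t := by
    obtain ⟨S, hS, hlt⟩ := hopen (σ t) (hσJ t ht)
    obtain ⟨κ, hκ, hle⟩ := hlow S hS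
    have hltS : t < τ S := by
      rw [← hσ t ht]; exact hmono (hσJ t ht) hS hlt
    have hmemS : ∀ x ∈ timeInterval T, x < τ S → σ x ∈ Icc 0 S := fun x hx hxS ↦
      ⟨hnonneg _ (hσJ x hx), by
        rw [← hmono.le_iff_le (hσJ _ hx) hS, hσ _ hx]; exact hxS.le⟩
    have hlim : Tendsto (fun x ↦ κ⁻¹ * |x - t|) (𝓝[timeInterval T] t) (𝓝 0) := by
      have : Continuous fun x ↦ κ⁻¹ * |x - t| := by fun_prop
      simpa using (this.tendsto t).mono_left nhdsWithin_le_nhds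
    rw [ContinuousWithinAt, tendsto_iff_norm_sub_tendsto_zero]
    refine squeeze_zero' (Eventually.of_forall fun _ ↦ norm_nonneg _) ?_ hlim
    filter_upwards [self_mem_nhdsWithin, mem_nhdsWithin_of_mem_nhds (Iio_mem_nhds hltS)]
      with x hx hxS
    rw [Real.norm_eq_abs, ← div_eq_inv_mul, le_div_iff₀ hκ, mul_comm]
    rcases le_total x t with h | h
    · have := hgrow hS hle (hσJ x hx) (hmemS t ht hltS) (hσmono hx ht h)
      rw [hσ x hx, hσ t ht] at this
      rw [abs_of_nonpos (by linarith [hσmono hx ht h]), abs_of_nonpos (by linarith)]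
      linarith
    · have := hgrow hS hle (hσJ t ht) (hmemS x hx hxS) (hσmono ht hx h)
      rw [hσ x hx, hσ t ht] at this
      rw [abs_of_nonneg (by linarith [hσmono ht hx h]), abs_of_nonneg (by linarith)]
      linarith
  have hslope := hasDerivWithinAt_iff_tendsto_slope.1 (hτ (σ t) (hσJ t ht))
  rw [hasDerivWithinAt_iff_tendsto_slope]
  have hinj : ∀ x ∈ timeInterval T \ {t}, σ x ∈ J \ {σ t} := fun x hx ↦
    ⟨hσJ x hx.1, fun h ↦ hx.2 (by
      have h' : σ x = σ t := h
      rw [mem_singleton_iff, ← hσ x hx.1, h', hσ t ht])⟩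
  have htend : Tendsto σ (𝓝[timeInterval T \ {t}] t) (𝓝[J \ {σ t}] (σ t)) :=
    tendsto_nhdsWithin_of_tendsto_nhds_of_eventually_within _
      (hcont.mono sdiff_subset) (by
        filter_upwards [self_mem_nhdsWithin] with x hx using hinj x hx)
  refine ((hslope.comp htend).inv₀ (hpos _ (hσJ t ht)).ne').congr' ?_
  filter_upwards [self_mem_nhdsWithin] with x hx
  simp only [Function.comp_apply, slope_def_field]
  rw [hσ t ht, hσ x hx.1, inv_div]

/-! ### Weak and strong derivatives -/

/-- The mean value inequality for `f y φ - (y - t) g(t) φ` gives an error `ε ‖φ‖ |x - t|`. Norm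
continuity of `g` makes `ε` independent of `φ`, which upgrades the weak derivative to a norm
derivative. -/
theorem hasDerivWithinAt_of_forall_apply {E : Type*} [NormedAddCommGroup E] [NormedSpace ℂ E]
    {f g : ℝ → StrongDual ℂ E} {S : Set ℝ} (hS : Convex ℝ S) (hg : ContinuousOn g S)
    (h : ∀ t ∈ S, ∀ φ, HasDerivWithinAt (fun τ ↦ f τ φ) (g t φ) S t) {t : ℝ} (ht : t ∈ S) :
    HasDerivWithinAt f (g t) S t := by
  rw [hasDerivWithinAt_iff_isLittleO, Asymptotics.isLittleO_iff]
  intro ε hε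
  obtain ⟨δ, hδ, hgδ⟩ := Metric.continuousWithinAt_iff.1 (hg t ht) ε hε
  filter_upwards [self_mem_nhdsWithin, mem_nhdsWithin_of_mem_nhds (Metric.ball_mem_nhds t hδ)]
    with x hx hxδ
  refine ContinuousLinearMap.opNorm_le_bound _ (by positivity) fun φ ↦ ?_
  have hder : ∀ y ∈ S ∩ Metric.ball t δ, HasDerivWithinAt (fun y ↦ f y φ - (y - t) • g t φ)
      (g y φ - g t φ) (S ∩ Metric.ball t δ) y := by
    intro y hy
    have h1 := (h y hy.1 φ).mono (t := S) (inter_subset_left (t := Metric.ball t δ))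
    have h2 : HasDerivWithinAt (fun y ↦ (y - t) • g t φ) ((1 : ℝ) • g t φ)
      (S ∩ Metric.ball t δ) y := ((hasDerivWithinAt_id y _).sub_const t).smul_const (g t φ)
    rw [one_smul] at h2
    exact h1.sub h2
  have hbound : ∀ y ∈ S ∩ Metric.ball t δ, ‖g y φ - g t φ‖ ≤ ε * ‖φ‖ := by
    intro y hy
    rw [← _root_.sub_apply]
    refine (g y - g t).le_of_opNorm_le ?_ φ
    rw [← dist_eq_norm]
    exact (hgδ hy.1 hy.2).le
  have := (hS.inter (convex_ball t δ)).norm_image_sub_le_of_norm_hasDerivWithin_le hder hbound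
    ⟨ht, Metric.mem_ball_self hδ⟩ ⟨hx, hxδ⟩
  calc ‖(f x - f t - (x - t) • g t) φ‖
      = ‖f x φ - (x - t) • g t φ - (f t φ - (t - t) • g t φ)‖ := by
        congr 1
        simp
        ring
    _ ≤ ε * ‖φ‖ * ‖x - t‖ := this
    _ = ε * ‖x - t‖ * ‖φ‖ := by ring

/-- The value at a continuous curve of a functional that vanishes at the base point. -/
theorem hasDerivWithinAt_sub_apply {E : Type*} [NormedAddCommGroup E] [NormedSpace ℂ E]
    {f : ℝ → StrongDual ℂ E} {f' : StrongDual ℂ E} {ψ : ℝ → E} {S : Set ℝ} {t : ℝ}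
    (hf : HasDerivWithinAt f f' S t) (hψ : ContinuousWithinAt ψ S t) :
    HasDerivWithinAt (fun τ ↦ (f τ - f t) (ψ τ)) (f' (ψ t)) S t := by
  rw [hasDerivWithinAt_iff_tendsto_slope] at hf ⊢
  have hψ' : Tendsto ψ (𝓝[S \ {t}] t) (𝓝 (ψ t)) := hψ.mono sdiff_subset
  have hc : Continuous fun p : StrongDual ℂ E × E ↦ p.1 p.2 := by fun_prop
  refine ((hc.tendsto (f', ψ t)).comp (hf.prodMk_nhds hψ')).congr fun x ↦ ?_
  simp [slope_def_module]

/-! ### Duality between `H¹` and `H⁻¹`, and testing along the free group -/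

namespace H1

@[simp]
theorem toHNeg1_apply (u φ : H1) : toHNeg1 u φ = pairing (toL2 u) (toL2 φ) := rfl

@[simp]
theorem dxx_apply (u φ : H1) : dxx u φ = -pairing (dx u) (dx φ) := rfl

theorem pairing_comm (f g : L2) : pairing f g = pairing g f := by
  simp only [pairing_eq_integral, mul_comm]

/-- The inclusion `H¹(ℝ) → H⁻¹(ℝ)` as a continuous linear map. -/
def toHNeg1L : H1 →L[ℂ] HNeg1 :=
  (ContinuousLinearMap.precomp ℂ toL2).comp (pairing.comp toL2)

@[simp]
theorem toHNeg1L_apply (u : H1) : toHNeg1L u = toHNeg1 u := rfl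

/-- The second derivative `H¹(ℝ) → H⁻¹(ℝ)` as a continuous linear map. -/
def dxxL : H1 →L[ℂ] HNeg1 :=
  -(ContinuousLinearMap.precomp ℂ dx).comp (pairing.comp dx)

@[simp]
theorem dxxL_apply (u : H1) : dxxL u = dxx u := rfl

/-- Schwartz functions already separate the points of `L²`. -/
theorem toHNeg1_injective : Function.Injective toHNeg1 := by
  refine (injective_iff_map_eq_zero toHNeg1L).2 fun u hu ↦ toL2_injective (Lp.ext ?_)
  rw [map_zero]
  refine EventuallyEq.trans ?_ (Lp.coeFn_zero ℂ 2 (volume : Measure ℝ)).symm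
  refine L2.ae_eq_of_forall_integral_eq (locallyIntegrable_L2 _) locallyIntegrable_zero fun φ ↦ ?_
  have h : toHNeg1 u (ofSchwartz φ) = 0 := by
    rw [← toHNeg1L_apply, hu]; rfl
  rw [toHNeg1_apply, pairing_comm, pairing_eq_integral] at h
  simp only [Pi.zero_apply, mul_zero, integral_zero]
  rw [← h]
  refine integral_congr_ae ?_
  filter_upwards [φ.coeFn_toLp 2 volume] with x hx
  rw [toL2_ofSchwartz, hx]

theorem pairing_group (s : ℝ) (u v : H1) :
    pairing (toL2 (group s u)) (toL2 v) = pairing (toL2 u) (toL2 (group s v)) :=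
  pairing_propagator s _ _

theorem pairing_dx_group (s : ℝ) (u v : H1) :
    pairing (dx (group s u)) (dx v) = pairing (dx u) (dx (group s v)) :=
  pairing_propagator s _ _

theorem hasDerivAt_pairing_group (u v : H1) (s : ℝ) :
    HasDerivAt (fun s ↦ pairing (toL2 (group s u)) (toL2 v))
      (-I * pairing (dx (group s u)) (dx v)) s :=
  hasDerivAt_pairing_propagator (mem_weakDerivGraph u) (mem_weakDerivGraph v) s

/-- The product rule for a curve in `H⁻¹(ℝ)` evaluated along an orbit of the group. -/
theorem hasDerivWithinAt_apply_group {S : Set ℝ} {t σ' : ℝ} {σ : ℝ → ℝ} {w : ℝ → H1} {w' : HNeg1}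
    (hσ : HasDerivWithinAt σ σ' S t)
    (hw : HasDerivWithinAt (fun τ ↦ toHNeg1 (w τ)) w' S t) (φ : H1) :
    HasDerivWithinAt (fun τ ↦ toHNeg1 (w τ) (group (σ τ) φ))
      (w' (group (σ t) φ) + σ' * (-I * pairing (dx (group (σ t) φ)) (dx (w t)))) S t := by
  have hψ : ContinuousWithinAt (fun τ ↦ group (σ τ) φ) S t :=
    (continuous_group φ).continuousAt.comp_continuousWithinAt hσ.continuousWithinAt
  have h1 := hasDerivWithinAt_sub_apply hw hψ
  have h2 := (hasDerivAt_pairing_group φ (w t) (σ t)).scomp_hasDerivWithinAt t hσ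
  -- The orbit of `φ` is only continuous in `H¹`. It is therefore differentiated only against the
  -- fixed `w t`, while the remaining factor vanishes at `t` and asks no more than continuity of the
  -- orbit.
  have h3 : (fun τ ↦ toHNeg1 (w τ) (group (σ τ) φ)) = fun τ ↦
      (toHNeg1 (w τ) - toHNeg1 (w t)) (group (σ τ) φ)
        + pairing (toL2 (group (σ τ) φ)) (toL2 (w t)) := by
    ext τ
    rw [_root_.sub_apply, toHNeg1_apply (w t), pairing_comm (toL2 (w t)), sub_add_cancel]
  rw [h3]
  refine (h1.fun_add h2).congr_deriv ?_
  rw [Complex.real_smul]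

/-- The curve `y(a) + ∫ g` is differentiable in `H¹`. Its difference from `y` has zero derivative
against every `φ`, so the two agree by injectivity of `toHNeg1`. -/
theorem hasDerivWithinAt_of_forall_toHNeg1_apply {y g : ℝ → H1} {a b : ℝ}
    (hg : ContinuousOn g (Icc a b))
    (h : ∀ t ∈ Icc a b, ∀ φ, HasDerivWithinAt (fun τ ↦ toHNeg1 (y τ) φ) (toHNeg1 (g t) φ)
      (Icc a b) t) {t : ℝ} (ht : t ∈ Icc a b) : HasDerivWithinAt y (g t) (Icc a b) t := by
  have hab : a ≤ b := ht.1.trans ht.2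
  set g' : ℝ → H1 := IccExtend hab (domRestrict (Icc a b) g) with hg'
  have hg'c : Continuous g' := hg.domRestrict.Icc_extend'
  have hgg' : ∀ s ∈ Icc a b, g' s = g s := fun s hs ↦ IccExtend_of_mem hab _ hs
  set Z : ℝ → H1 := fun s ↦ y a + ∫ x in a..s, g' x with hZ
  have hZd : ∀ s, HasDerivAt Z (g' s) s := fun s ↦
    (hg'c.integral_hasStrictDerivAt a s).hasDerivAt.const_add (y a)
  have hyZ : ∀ s ∈ Icc a b, y s = Z s := by
    intro s hs
    refine toHNeg1_injective (ContinuousLinearMap.ext fun φ ↦ ?_)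
    have hφ : ∀ x ∈ Icc a b,
        HasDerivWithinAt (fun τ ↦ toHNeg1 (y τ) φ - toHNeg1 (Z τ) φ) 0 (Icc a b) x := by
      intro x hx
      have h1 := h x hx φ
      let ℓ : H1 →L[ℝ] ℂ := (toHNeg1L.flip φ).restrictScalars ℝ
      have h2 : HasDerivWithinAt (fun τ ↦ toHNeg1 (Z τ) φ) (toHNeg1 (g' x) φ) (Icc a b) x :=
        (ℓ.hasFDerivAt.comp_hasDerivAt x (hZd x)).hasDerivWithinAt
      rw [hgg' x hx] at h2
      exact (h1.fun_sub h2).congr_deriv (sub_self _)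
    have := constant_of_derivWithin_zero (fun x hx ↦ (hφ x hx).differentiableWithinAt)
      (fun x hx ↦ (hφ x (Ico_subset_Icc_self hx)).derivWithin
        (uniqueDiffOn_Icc (hx.1.trans_lt hx.2) x (Ico_subset_Icc_self hx))) s hs
    have hZa : Z a = y a := by simp [hZ]
    rw [hZa, sub_self] at this
    exact sub_eq_zero.1 this
  have := (hZd t).hasDerivWithinAt (s := Icc a b)
  rw [hgg' t ht] at this
  exact this.congr_of_mem hyZ ht

end H1

/-! ### The profile equation -/

theorem IsLocallyC11.continuous_superposition {h : ℂ → ℂ} {h' : ℂ → ℂ →L[ℝ] ℂ}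
    (H : IsLocallyC11 h h') : Continuous H.superposition := by
  refine continuous_iff_continuousAt.2 fun u ↦ ?_
  obtain ⟨C, hC, hlip⟩ := H.exists_lipschitz_superposition (‖u‖ + 1)
  rw [ContinuousAt, tendsto_iff_norm_sub_tendsto_zero]
  have h0 : Tendsto (fun w ↦ C * ‖w - u‖) (𝓝 u) (𝓝 0) := by
    have : Continuous fun w ↦ C * ‖w - u‖ := by fun_prop
    simpa using this.tendsto u
  refine squeeze_zero' (Eventually.of_forall fun _ ↦ norm_nonneg _) ?_ h0
  have hev : ∀ᶠ w in 𝓝 u, ‖w‖ < ‖u‖ + 1 :=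
    (continuous_norm.tendsto u).eventually_lt_const (by linarith)
  filter_upwards [hev] with w hw
  exact hlip w u hw.le (by linarith)

/-- The Kirchhoff coefficient `1 + ∫ |uₓ|²`. -/
def coeff (u : H1) : ℝ := 1 + ‖H1.dx u‖ ^ 2

theorem one_le_coeff (u : H1) : 1 ≤ coeff u := by
  unfold coeff
  nlinarith [sq_nonneg ‖H1.dx u‖]

theorem coeff_pos (u : H1) : 0 < coeff u := one_pos.trans_le (one_le_coeff u)

theorem continuous_coeff : Continuous coeff := by
  unfold coeff
  fun_prop

/-- This invariance makes the new time computable from the profile alone and closes the profile ODE.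
-/
theorem coeff_group (s : ℝ) (u : H1) : coeff (H1.group s u) = coeff u := by
  rw [coeff, coeff, H1.norm_dx_group]

theorem coeff_le {u : H1} {M : ℝ} (hu : ‖u‖ ≤ M) : coeff u ≤ 1 + M ^ 2 := by
  have := (H1.norm_dx_le u).trans hu
  unfold coeff
  gcongr

theorem abs_inv_coeff_sub_le {M : ℝ} {u v : H1} (hu : ‖u‖ ≤ M) (hv : ‖v‖ ≤ M) :
    |(coeff u)⁻¹ - (coeff v)⁻¹| ≤ 2 * M * ‖u - v‖ := by
  have h1 : |coeff u - coeff v| ≤ 2 * M * ‖u - v‖ := by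
    have e : coeff u - coeff v =
        (‖H1.dx u‖ + ‖H1.dx v‖) * (‖H1.dx u‖ - ‖H1.dx v‖) := by
      unfold coeff; ring
    rw [e, abs_mul, abs_of_nonneg (by positivity)]
    have h2 := (H1.norm_dx_le u).trans hu
    have h3 := (H1.norm_dx_le v).trans hv
    have h4 : |‖H1.dx u‖ - ‖H1.dx v‖| ≤ ‖u - v‖ := by
      refine (abs_norm_sub_norm_le _ _).trans ?_
      rw [← map_sub]
      exact H1.norm_dx_le _
    exact mul_le_mul (by linarith) h4 (abs_nonneg _) (by linarith [norm_nonneg (H1.dx u)])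
  have hu1 := one_le_coeff u
  have hv1 := one_le_coeff v
  rw [inv_sub_inv (coeff_pos u).ne' (coeff_pos v).ne', abs_div, abs_sub_comm,
    abs_of_pos (mul_pos (coeff_pos u) (coeff_pos v))]
  refine (div_le_self (abs_nonneg _) ?_).trans h1
  nlinarith

section Field

variable {r : ℝ} (hr : 1 ≤ r)

/-- The nonlinearity `u ↦ |u|^{2r} u` on `H¹(ℝ)`. -/
def nonlin (u : H1) : H1 := (isLocallyC11_power hr).superposition u

/-- The nonlinear term in the interaction picture. -/
def forcing (s : ℝ) (x : H1) : H1 := H1.group (-s) (I • nonlin hr (H1.group s x))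

/-- The vector field of the equation satisfied, in the time variable `s` with
`dt/ds = (1 + ∫ |uₓ|²)⁻¹`, by the profile `e^{-i s ∂ₓ²} u`. -/
def field (s : ℝ) (x : H1) : H1 := (coeff x)⁻¹ • forcing hr s x

theorem continuous_nonlin : Continuous (nonlin hr) :=
  (isLocallyC11_power hr).continuous_superposition

theorem toHNeg1_nonlin_apply (u φ : H1) : H1.toHNeg1 (nonlin hr u) φ =
    ∫ x, ((‖H1.toL2 u x‖ ^ (2 * r) : ℝ) : ℂ) * H1.toL2 u x * H1.toL2 φ x := by
  rw [H1.toHNeg1_apply, pairing_eq_integral]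
  refine integral_congr_ae ?_
  filter_upwards [(isLocallyC11_power hr).toL2_superposition u] with x hx
  rw [nonlin, hx, power, Complex.real_smul]

/-- The group is isometric on `H¹`, so the bounds on the nonlinearity hold uniformly in `s`. The
factor `(coeff x)⁻¹` is at most `1` and locally Lipschitz because `coeff` is at least `1`. -/
theorem isLipschitzOnBounded_field : IsLipschitzOnBounded (field hr) := by
  have hforce : ∀ M : ℝ, ∃ C : ℝ, 0 ≤ C ∧ ∀ s x y, ‖x‖ ≤ M → ‖y‖ ≤ M →
      ‖forcing hr s x - forcing hr s y‖ ≤ C * ‖x - y‖ := by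
    intro M
    obtain ⟨C, hC, hlip⟩ := (isLocallyC11_power hr).exists_lipschitz_superposition M
    refine ⟨C, hC, fun s x y hx hy ↦ ?_⟩
    rw [forcing, forcing, ← map_sub, LinearIsometry.norm_map, ← smul_sub, norm_smul,
      Complex.norm_I, one_mul]
    have := hlip (H1.group s x) (H1.group s y) (by simpa using hx) (by simpa using hy)
    rwa [← map_sub, LinearIsometry.norm_map] at this
  have hbound : ∀ M : ℝ, ∃ L : ℝ, 0 ≤ L ∧ ∀ s x, ‖x‖ ≤ M → ‖forcing hr s x‖ ≤ L := by
    intro M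
    obtain ⟨C, hC, hlip⟩ := hforce M
    refine ⟨‖nonlin hr 0‖ + C * |M|, by positivity, fun s x hx ↦ ?_⟩
    have h1 := hlip s x 0 hx (by simpa using (norm_nonneg x).trans hx)
    have h2 : ‖forcing hr s 0‖ = ‖nonlin hr 0‖ := by
      rw [forcing, LinearIsometry.norm_map, norm_smul, Complex.norm_I, one_mul, map_zero]
    have h3 : ‖forcing hr s x‖ ≤ ‖forcing hr s 0‖ + ‖forcing hr s x - forcing hr s 0‖ := by
      simpa using norm_add_le (forcing hr s 0) (forcing hr s x - forcing hr s 0)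
    have h4 : C * ‖x - 0‖ ≤ C * |M| := by
      rw [sub_zero]
      exact mul_le_mul_of_nonneg_left (hx.trans (le_abs_self M)) hC
    linarith
  have hinv : ∀ x, ‖(coeff x)⁻¹‖ ≤ 1 := fun x ↦ by
    rw [Real.norm_of_nonneg (inv_nonneg.2 (coeff_pos x).le)]
    exact inv_le_one_of_one_le₀ (one_le_coeff x)
  refine ⟨fun x ↦ ?_, fun M ↦ ?_, fun M ↦ ?_⟩
  · have h1 : Continuous fun s : ℝ ↦ I • nonlin hr (H1.group s x) :=
      ((continuous_nonlin hr).comp (H1.continuous_group x)).const_smul I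
    exact (H1.continuous_group_uncurry.comp (continuous_neg.prodMk h1)).const_smul _
  · obtain ⟨C, hC, hlip⟩ := hforce M
    obtain ⟨L, hL, hb⟩ := hbound M
    have hK : 0 ≤ C + 2 * |M| * L := by positivity
    refine ⟨NNReal.mk (C + 2 * |M| * L) hK, fun s ↦ LipschitzOnWith.of_dist_le_mul fun x hx y hy ↦ ?_⟩
    have hx' : ‖x‖ ≤ M := by simpa using hx
    have hy' : ‖y‖ ≤ M := by simpa using hy
    have e : field hr s x - field hr s y = (coeff x)⁻¹ • (forcing hr s x - forcing hr s y) +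
        ((coeff x)⁻¹ - (coeff y)⁻¹) • forcing hr s y := by
      rw [field, field, smul_sub, sub_smul]; abel
    rw [dist_eq_norm, dist_eq_norm, e, NNReal.coe_mk, add_mul]
    refine (norm_add_le _ _).trans (add_le_add ?_ ?_)
    · rw [norm_smul]
      have := mul_le_mul (hinv x) (hlip s x y hx' hy') (norm_nonneg _) zero_le_one
      rwa [one_mul] at this
    · rw [norm_smul, Real.norm_eq_abs]
      have h1 := abs_inv_coeff_sub_le hx' hy'
      have h2 : 2 * M * ‖x - y‖ ≤ 2 * |M| * ‖x - y‖ := by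
        have := le_abs_self M
        gcongr
      calc _ ≤ (2 * |M| * ‖x - y‖) * L :=
            mul_le_mul (h1.trans h2) (hb s y hy') (norm_nonneg _) (by positivity)
        _ = _ := by ring
  · obtain ⟨L, hL, hb⟩ := hbound M
    refine ⟨NNReal.mk L hL, fun s x hx ↦ ?_⟩
    rw [field, norm_smul]
    have := mul_le_mul (hinv x) (hb s x hx) (norm_nonneg _) zero_le_one
    rwa [one_mul] at this

/-! ### The equation in weak form -/

theorem integral_norm_sq_L2 (f : L2) : ∫ x, ‖f x‖ ^ 2 = ‖f‖ ^ 2 := by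
  rw [← @inner_self_eq_norm_sq ℂ, L2.inner_def, ← integral_re (L2.integrable_inner _ _)]
  refine integral_congr_ae (Eventually.of_forall fun x ↦ ?_)
  simp only [inner_self_eq_norm_sq]

/-- The time derivative prescribed by the equation. -/
def timeDeriv (u : H1) : HNeg1 :=
  I • ((coeff u : ℂ) • H1.dxxL u + H1.toHNeg1L (nonlin hr u))

theorem continuous_timeDeriv : Continuous (timeDeriv hr) := by
  unfold timeDeriv
  refine Continuous.const_smul (Continuous.add ?_ ?_) I
  · exact (Complex.continuous_ofReal.comp continuous_coeff).smul H1.dxxL.continuous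
  · exact H1.toHNeg1L.continuous.comp (continuous_nonlin hr)

theorem timeDeriv_apply (u φ : H1) : timeDeriv hr u φ =
    I * (-(coeff u * pairing (H1.dx u) (H1.dx φ)) + H1.toHNeg1 (nonlin hr u) φ) := by
  simp [timeDeriv, mul_add]

theorem equation_iff (u φ : H1) (a : ℂ) :
    I * a + ((1 + ∫ x, ‖H1.dx u x‖ ^ 2 : ℝ) : ℂ) * H1.dxx u φ
      + ∫ x, ((‖H1.toL2 u x‖ ^ (2 * r) : ℝ) : ℂ) * H1.toL2 u x * H1.toL2 φ x = 0 ↔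
    a = timeDeriv hr u φ := by
  rw [integral_norm_sq_L2, ← toHNeg1_nonlin_apply hr, timeDeriv_apply, H1.dxx_apply,
    ← coeff]
  constructor <;> intro h
  · linear_combination (-I) * h + a * Complex.I_sq
  · rw [h]
    linear_combination (-(coeff u * pairing (H1.dx u) (H1.dx φ)) + H1.toHNeg1 (nonlin hr u) φ) *
      Complex.I_sq

/-- A differentiable profile yields a solution. -/
theorem isSolution_of_profile {u₀ : H1} {T : EReal} {σ : ℝ → ℝ} {y : ℝ → H1}
    (h0 : H1.group (σ 0) (y 0) = u₀)
    (hσ : ∀ t ∈ timeInterval T, HasDerivWithinAt σ (coeff (y t)) (timeInterval T) t)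
    (hy : ∀ t ∈ timeInterval T, HasDerivWithinAt y (forcing hr (σ t) (y t)) (timeInterval T) t) :
    IsSolution r u₀ T fun t ↦ H1.group (σ t) (y t) := by
  have hcont : ContinuousOn (fun t ↦ H1.group (σ t) (y t)) (timeInterval T) := fun t ht ↦
    (H1.continuous_group_uncurry.continuousAt (x := (σ t, y t))).comp_continuousWithinAt
      (f := fun t ↦ (σ t, y t))
      ((hσ t ht).continuousWithinAt.prodMk (hy t ht).continuousWithinAt)
  have hut : ContinuousOn (fun t ↦ timeDeriv hr (H1.group (σ t) (y t))) (timeInterval T) :=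
    (continuous_timeDeriv hr).comp_continuousOn hcont
  refine ⟨hcont, h0, fun t ↦ timeDeriv hr (H1.group (σ t) (y t)), hut, fun t ht ↦
    ⟨?_, fun φ ↦ (equation_iff hr _ _ _).2 rfl⟩⟩
  -- Since the prescribed derivative is already continuous in `H⁻¹`, it suffices to differentiate
  -- against each fixed `φ`. There the group moves onto `φ`, and the product rule produces the
  -- second-derivative term with factor `σ' = coeff`.
  refine hasDerivWithinAt_of_forall_apply (convex_timeInterval T) hut (fun t ht φ ↦ ?_) ht
  have hy' : HasDerivWithinAt (fun τ ↦ H1.toHNeg1 (y τ)) (H1.toHNeg1 (forcing hr (σ t) (y t)))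
      (timeInterval T) t :=
    (H1.toHNeg1L.restrictScalars ℝ).hasFDerivAt.comp_hasDerivWithinAt t (hy t ht)
  have h1 := H1.hasDerivWithinAt_apply_group (hσ t ht) hy' φ
  have e : ∀ τ, H1.toHNeg1 (y τ) (H1.group (σ τ) φ) = H1.toHNeg1 (H1.group (σ τ) (y τ)) φ :=
    fun τ ↦ (H1.pairing_group (σ τ) (y τ) φ).symm
  simp only [e] at h1
  refine h1.congr_deriv ?_
  rw [timeDeriv_apply, coeff_group, H1.pairing_dx_group, H1.pairing_comm (H1.dx φ),
    H1.toHNeg1_apply, ← H1.pairing_group, forcing, H1.group_group_neg, map_smul, map_smul,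
    H1.toHNeg1_apply]
  simp only [_root_.smul_apply, smul_eq_mul]
  ring

/-- The profile of a solution is differentiable in `H¹(ℝ)`. -/
theorem hasDerivWithinAt_profile {u₀ : H1} {T : EReal} {v : ℝ → H1} (hv : IsSolution r u₀ T v)
    {b : ℝ} (hb : b ∈ timeInterval T) {σ : ℝ → ℝ}
    (hσ : ∀ t ∈ Icc 0 b, HasDerivWithinAt σ (coeff (v t)) (Icc 0 b) t) {t : ℝ}
    (ht : t ∈ Icc 0 b) :
    HasDerivWithinAt (fun t ↦ H1.group (-σ t) (v t))
      (forcing hr (σ t) (H1.group (-σ t) (v t))) (Icc 0 b) t := by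
  have hsub := Icc_subset_timeInterval hb
  obtain ⟨ut, -, hut⟩ := hv.equation
  have hσc : ContinuousOn σ (Icc 0 b) := fun t ht ↦ (hσ t ht).continuousWithinAt
  have hvc : ContinuousOn v (Icc 0 b) := hv.continuousOn.mono hsub
  have hforce : ∀ t, forcing hr (σ t) (H1.group (-σ t) (v t)) =
      H1.group (-σ t) (I • nonlin hr (v t)) := fun t ↦ by
    rw [forcing, H1.group_group_neg]
  refine H1.hasDerivWithinAt_of_forall_toHNeg1_apply
    (g := fun t ↦ forcing hr (σ t) (H1.group (-σ t) (v t))) ?_ (fun t ht φ ↦ ?_) ht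
  · simp only [hforce]
    have h1 : ContinuousOn (fun t ↦ I • nonlin hr (v t)) (Icc 0 b) :=
      ((continuous_nonlin hr).comp_continuousOn hvc).const_smul I
    exact H1.continuous_group_uncurry.comp_continuousOn
      (f := fun t ↦ (-σ t, I • nonlin hr (v t))) (hσc.fun_neg.prodMk h1)
  · obtain ⟨hd, heq⟩ := hut t (hsub ht)
    have hut' : ∀ ψ, ut t ψ = timeDeriv hr (v t) ψ := fun ψ ↦ (equation_iff hr _ _ _).1 (heq ψ)
    have h1 := H1.hasDerivWithinAt_apply_group (hσ t ht).fun_neg (hd.mono hsub) φ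
    have e : ∀ τ, H1.toHNeg1 (v τ) (H1.group (-σ τ) φ) = H1.toHNeg1 (H1.group (-σ τ) (v τ)) φ :=
      fun τ ↦ (H1.pairing_group (-σ τ) (v τ) φ).symm
    simp only [e] at h1
    refine h1.congr_deriv ?_
    -- The second-derivative term of the equation cancels the one produced by the group, because `σ'
    -- = coeff (v t)`. Only the forcing, which lies in `H¹`, is left.
    rw [hut', timeDeriv_apply, H1.pairing_comm (H1.dx (v t)), hforce, H1.toHNeg1_apply (H1.group _ _),
      H1.pairing_group, map_smul, map_smul, H1.toHNeg1_apply]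
    simp only [_root_.smul_apply, smul_eq_mul]
    push_cast
    ring

end Field

/-! ### Comparison of an arbitrary solution with the maximal profile -/

theorem hasDerivWithinAt_smul_field {r : ℝ} (hr : 1 ≤ r) {S J : Set ℝ} {σ : ℝ → ℝ} {z : ℝ → H1}
    {a t : ℝ} (hσ : HasDerivWithinAt σ a S t)
    (hz : HasDerivWithinAt z (field hr (σ t) (z (σ t))) J (σ t)) (hmaps : MapsTo σ S J) :
    HasDerivWithinAt (fun t ↦ z (σ t)) (a • field hr (σ t) (z (σ t))) S t :=
  HasDerivWithinAt.scomp t hz hσ hmaps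

theorem forcing_eq_smul_field {r : ℝ} (hr : 1 ≤ r) (s : ℝ) (x : H1) :
    forcing hr s x = coeff x • field hr s x := by
  rw [field, smul_smul, mul_inv_cancel₀ (coeff_pos x).ne', one_smul]

/-- Along a solution, the profile in the new time follows the maximal solution of the profile
equation. -/
theorem exists_newTime {r : ℝ} (hr : 1 ≤ r) {u₀ : H1} {J : Set ℝ} {z : ℝ → H1} (h0 : (0 : ℝ) ∈ J)
    (hdown : ∀ s ∈ J, Icc 0 s ⊆ J) (hz0 : z 0 = u₀)
    (hz : ∀ s ∈ J, HasDerivWithinAt z (field hr s (z s)) J s)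
    (hext : ∀ M : ℝ, ∃ δ : ℝ, 0 < δ ∧ ∀ s ∈ J, ‖z s‖ ≤ M → s + δ ∈ J)
    {T : EReal} {v : ℝ → H1} (hv : IsSolution r u₀ T v) {b : ℝ} (hb : b ∈ timeInterval T) :
    ∃ θ : ℝ → ℝ, θ 0 = 0 ∧ ∀ t ∈ Icc 0 b, HasDerivWithinAt θ (coeff (v t)) (Icc 0 b) t ∧
      θ t ∈ J ∧ H1.group (θ t) (z (θ t)) = v t := by
  have hb0 : 0 ≤ b := hb.1
  have hvc : ContinuousOn v (Icc 0 b) := hv.continuousOn.mono (Icc_subset_timeInterval hb)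
  set v' : ℝ → H1 := IccExtend hb0 (domRestrict (Icc 0 b) v)
  have hv'c : Continuous fun t ↦ coeff (v' t) := continuous_coeff.comp hvc.domRestrict.Icc_extend'
  have hv' : ∀ s ∈ Icc 0 b, v' s = v s := fun s hs ↦ IccExtend_of_mem hb0 _ hs
  set θ : ℝ → ℝ := fun t ↦ ∫ x in (0 : ℝ)..t, coeff (v' x)
  have hθ0 : θ 0 = 0 := intervalIntegral.integral_same
  have hθ : ∀ t ∈ Icc 0 b, HasDerivWithinAt θ (coeff (v t)) (Icc 0 b) t := by
    intro t ht
    rw [← hv' t ht]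
    exact (hv'c.integral_hasStrictDerivAt 0 t).hasDerivAt.hasDerivWithinAt
  have hθc : ContinuousOn θ (Icc 0 b) := fun t ht ↦ (hθ t ht).continuousWithinAt
  have hmono : ∀ {s t}, s ∈ Icc 0 b → t ∈ Icc 0 b → s ≤ t → θ s ≤ θ t := by
    intro s t hs ht hst
    have hsub : Icc s t ⊆ Icc 0 b := Icc_subset_Icc hs.1 ht.2
    have := mul_sub_le_of_hasDerivWithinAt (κ := 0) hst
      (fun x hx ↦ (hθ x (hsub hx)).mono hsub) fun x _ ↦ (coeff_pos _).le
    linarith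
  set y : ℝ → H1 := fun t ↦ H1.group (-θ t) (v t) with hydef
  have hcy : ∀ t, coeff (y t) = coeff (v t) := fun t ↦ coeff_group _ _
  have hyd : ∀ t ∈ Icc 0 b,
      HasDerivWithinAt y (coeff (v t) • field hr (θ t) (y t)) (Icc 0 b) t := by
    intro t ht
    rw [← hcy t, ← forcing_eq_smul_field]
    exact hasDerivWithinAt_profile hr hv hb hθ ht
  have hyz : ∀ t ∈ Icc 0 b, θ t ∈ J → y t = z (θ t) := by
    intro t ht htJ
    have hsub : Icc 0 t ⊆ Icc 0 b := Icc_subset_Icc_right ht.2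
    have hmaps : MapsTo θ (Icc 0 t) J := fun x hx ↦ hdown _ htJ
      ⟨by rw [← hθ0]; exact hmono ⟨le_rfl, hb0⟩ (hsub hx) hx.1, hmono (hsub hx) ht hx.2⟩
    obtain ⟨A, hA⟩ := isCompact_Icc.exists_bound_of_continuousOn
      (continuous_coeff.comp_continuousOn hvc)
    -- In the old time both curves solve one equation in which the coefficient of the given `v` is a
    -- known function of `t`, bounded by `A` on the compact interval.
    refine eqOn_of_hasDerivWithinAt_Icc (v := fun t x ↦ coeff (v t) • field hr (θ t) x)
      (f := y) (g := fun t ↦ z (θ t)) (fun M ↦ ?_) (fun x hx ↦ (hyd x (hsub hx)).mono hsub)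
      (fun x hx ↦ ?_) ?_ (⟨ht.1, le_rfl⟩ : t ∈ Icc 0 t)
    · obtain ⟨K, hK⟩ := (isLipschitzOnBounded_field hr).lipschitz M
      refine ⟨A.toNNReal * K, fun x hx ↦ LipschitzOnWith.of_dist_le_mul fun p hp q hq ↦ ?_⟩
      have h1 := hA x (hsub hx)
      have h2 := (hK (θ x)).dist_le_mul p hp q hq
      rw [dist_smul₀, NNReal.coe_mul, mul_assoc]
      exact mul_le_mul (h1.trans (Real.le_coe_toNNReal A)) h2 dist_nonneg (NNReal.coe_nonneg _)
    · exact hasDerivWithinAt_smul_field hr ((hθ x (hsub hx)).mono hsub) (hz _ (hmaps hx)) hmaps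
    · simp only [hydef]
      rw [hθ0, hz0, neg_zero, H1.group_zero, hv.initial]
  -- Otherwise `J` is bounded by `θ b`. Points of `J` close to `sSup J` are values of `θ`, where `z`
  -- has the norm of `v` and hence is bounded by `M`; continuation by `δ` then passes the supremum.
  have hbJ : θ b ∈ J := by
    by_contra hnot
    obtain ⟨M, hM⟩ := isCompact_Icc.exists_bound_of_continuousOn hvc
    obtain ⟨δ, hδ, hstep⟩ := hext M
    have hθb : 0 ≤ θ b := by
      rw [← hθ0]; exact hmono ⟨le_rfl, hb0⟩ ⟨hb0, le_rfl⟩ hb0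
    have hup : ∀ s ∈ J, s ≤ θ b := fun s hs ↦ by
      by_contra! hlt
      exact hnot (hdown s hs ⟨hθb, hlt.le⟩)
    have hbdd : BddAbove J := ⟨θ b, hup⟩
    obtain ⟨s, hs, hlt⟩ := exists_lt_of_lt_csSup ⟨0, h0⟩ (sub_lt_self (sSup J) hδ)
    -- Replacing `s` by `max s 0` puts it in the range of `θ`, as points of `J` are not assumed
    -- nonnegative here.
    have hs' : max s 0 ∈ J := by
      rcases max_choice s 0 with h | h <;> rw [h] <;> assumption
    obtain ⟨t, ht, hts⟩ := intermediate_value_Icc hb0 hθc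
      (show max s 0 ∈ Icc (θ 0) (θ b) from ⟨by rw [hθ0]; exact le_max_right _ _, hup _ hs'⟩)
    have htJ : θ t ∈ J := by rw [hts]; exact hs'
    have hnorm : ‖z (θ t)‖ ≤ M := by
      rw [← hyz t ht htJ, hydef]
      simpa using hM t ht
    have := le_csSup hbdd (hstep _ htJ hnorm)
    rw [hts] at this
    linarith [le_max_left s 0]
  have hJ : ∀ t ∈ Icc 0 b, θ t ∈ J := fun t ht ↦ hdown _ hbJ
    ⟨by rw [← hθ0]; exact hmono ⟨le_rfl, hb0⟩ ht ht.1, hmono ht ⟨hb0, le_rfl⟩ ht.2⟩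
  refine ⟨θ, hθ0, fun t ht ↦ ⟨hθ t ht, hJ t ht, ?_⟩⟩
  rw [← hyz t ht (hJ t ht), hydef]
  exact H1.group_group_neg _ _

theorem eq_self_of_hasDerivWithinAt_one {f : ℝ → ℝ} {b : ℝ} (hb : 0 ≤ b) (h0 : f 0 = 0)
    (hf : ∀ t ∈ Icc 0 b, HasDerivWithinAt f 1 (Icc 0 b) t) : f b = b := by
  have h1 := mul_sub_le_of_hasDerivWithinAt (f' := fun _ ↦ 1) (κ := 1) hb hf fun _ _ ↦ le_rfl
  have h2 := mul_sub_le_of_hasDerivWithinAt (f' := fun _ ↦ -1) (κ := -1) hb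
    (fun t ht ↦ (hf t ht).fun_neg) fun _ _ ↦ le_rfl
  linarith

end SchrodingerKirchhoff

end

/-! ### Existence, uniqueness, maximality and blow-up -/

open SchrodingerKirchhoff in
theorem proposition2p2 (r : ℝ) (hr : 1 ≤ r) (u₀ : H1) :
    ∃ Tmax : EReal, 0 < Tmax ∧ ∃ u : ℝ → H1,
      IsSolution r u₀ Tmax u ∧
      (∀ T : EReal, 0 < T → ∀ v : ℝ → H1, IsSolution r u₀ T v →
        T ≤ Tmax ∧ EqOn v u (timeInterval T)) ∧
      (∀ T : ℝ, Tmax = T → Tendsto (fun t ↦ ‖u t‖) (𝓝[<] T) atTop) := by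
  obtain ⟨J, z, h0, hnonneg, hdown, hz0, hz, hext⟩ :=
    (isLipschitzOnBounded_field hr).exists_maximal u₀
  have hopen : ∀ s ∈ J, ∃ s' ∈ J, s < s' := fun s hs ↦ by
    obtain ⟨δ, hδ, h⟩ := hext ‖z s‖
    exact ⟨s + δ, (h s hs le_rfl).1, by linarith⟩
  have hcc : ContinuousOn (fun s ↦ (coeff (z s))⁻¹) J := fun s hs ↦
    (continuous_coeff.continuousAt.comp_continuousWithinAt (hz s hs).continuousWithinAt).inv₀
      (coeff_pos _).ne'
  obtain ⟨Tmax, τ, σ, hT, hτ0, hτ, hτmono, hτmaps, hσ, hσd⟩ := exists_timeChange h0 hnonneg hdown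
    hopen hcc fun s _ ↦ inv_pos.2 (coeff_pos _)
  simp only [inv_inv] at hσd
  have h0T : (0 : ℝ) ∈ timeInterval Tmax := ⟨le_rfl, by simpa using hT⟩
  have hσ0 : σ 0 = 0 := hτmono.injOn (hσ 0 h0T).1 h0 (by rw [(hσ 0 h0T).2, hτ0])
  have hmain : ∀ (T : EReal) (v : ℝ → H1), IsSolution r u₀ T v → ∀ b ∈ timeInterval T,
      b ∈ timeInterval Tmax ∧ v b = H1.group (σ b) (z (σ b)) := by
    intro T v hv b hb
    obtain ⟨θ, hθ0, hθ⟩ := exists_newTime hr h0 hdown hz0 hz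
      (fun M ↦ (hext M).imp fun δ h ↦ ⟨h.1, fun s hs hM ↦ (h.2 s hs hM).1⟩) hv hb
    -- The speeds of `τ` and `θ` are `(coeff z)⁻¹` and `coeff v`, which are reciprocal along the
    -- solution, so `τ ∘ θ` has derivative `1`. This shows `b < Tmax` and identifies `θ` with `σ`.
    have hτθ : τ (θ b) = b := by
      refine eq_self_of_hasDerivWithinAt_one (f := fun t ↦ τ (θ t)) hb.1 (by rw [hθ0, hτ0])
        fun t ht ↦ ?_
      obtain ⟨hd, hJ, heq⟩ := hθ t ht
      refine ((hτ _ hJ).comp t hd fun x hx ↦ (hθ x hx).2.1).congr_deriv ?_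
      rw [← heq, coeff_group]
      exact inv_mul_cancel₀ (coeff_pos _).ne'
    obtain ⟨-, hJ, heq⟩ := hθ b ⟨hb.1, le_rfl⟩
    have hbT : b ∈ timeInterval Tmax := by
      rw [← hτθ]; exact hτmaps hJ
    have hσθ : σ b = θ b := hτmono.injOn (hσ b hbT).1 hJ (by rw [(hσ b hbT).2, hτθ])
    exact ⟨hbT, by rw [hσθ, heq]⟩
  refine ⟨Tmax, hT, fun t ↦ H1.group (σ t) (z (σ t)), ?_, fun T _ v hv ↦ ⟨?_, fun b hb ↦
    (hmain T v hv b hb).2⟩, fun T hTT ↦ ?_⟩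
  · refine isSolution_of_profile hr (y := fun t ↦ z (σ t)) ?_ hσd fun t ht ↦ ?_
    · rw [hσ0, H1.group_zero, hz0]
    · rw [forcing_eq_smul_field]
      exact hasDerivWithinAt_smul_field hr (hσd t ht) (hz _ (hσ t ht).1) fun x hx ↦ (hσ x hx).1
  · by_contra! hlt
    obtain ⟨b, hb1, hb2⟩ := EReal.lt_iff_exists_real_btwn.1 hlt
    have hb0 : (0 : ℝ) ≤ b := EReal.coe_le_coe_iff.1 (by simpa using (hT.trans hb1).le)
    exact absurd (hmain T v hv b ⟨hb0, hb2⟩).1.2 hb1.not_gt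
  · subst hTT
    have hT0 : 0 < T := by simpa using hT
    simp only [LinearIsometry.norm_map]
    refine tendsto_atTop.2 fun M ↦ ?_
    obtain ⟨δ, hδ, hstep⟩ := hext M
    -- If `‖u t‖ < M`, the profile lives for a further new time `δ` with norm at most `M + 1`. There
    -- `dt/ds` is at least `(1 + (M + 1)²)⁻¹`, so `t` lies at least this product before `T`.
    have hκ : 0 < (1 + (M + 1) ^ 2)⁻¹ * δ := by positivity
    filter_upwards [self_mem_nhdsWithin, mem_nhdsWithin_of_mem_nhds (Ioi_mem_nhds hT0),
      mem_nhdsWithin_of_mem_nhds (Ioi_mem_nhds (sub_lt_self T hκ))] with t htT ht0 htκ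
    have ht : t ∈ timeInterval (T : EReal) := ⟨le_of_lt ht0, EReal.coe_lt_coe_iff.2 htT⟩
    by_contra! hlt
    obtain ⟨hσJ, hστ⟩ := hσ t ht
    obtain ⟨hJ, hbound⟩ := hstep _ hσJ hlt.le
    have hsub : Icc (σ t) (σ t + δ) ⊆ J := fun x hx ↦
      hdown _ hJ ⟨(hnonneg _ hσJ).trans hx.1, hx.2⟩
    have h1 := mul_sub_le_of_hasDerivWithinAt (κ := (1 + (M + 1) ^ 2)⁻¹)
      (by linarith : σ t ≤ σ t + δ) (fun s hs ↦ (hτ s (hsub hs)).mono hsub) fun s hs ↦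
        inv_anti₀ (coeff_pos _) (coeff_le (hbound s hs))
    have h2 : τ (σ t + δ) < T := EReal.coe_lt_coe_iff.1 (hτmaps hJ).2
    rw [hστ, add_sub_cancel_left] at h1
    have h3 : T - (1 + (M + 1) ^ 2)⁻¹ * δ < t := htκ
    linarith
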